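/- Let $n\ge 1$ and let $a_i$ ($i\in\iota$), $b_j$ ($j\in\kappa$) be finitely many nonzero homogeneous polynomials in $\mathbb C[x_1,\dots,x_n]$, and let $\nu_i,\rho_j\in\mathbb C$ satisfy $\operatorname{Re}\nu_i,\operatorname{Re}\rho_j\ge 0$ and $\sum_i\nu_i\deg a_i=\sum_j\rho_j\deg b_j$. For each polynomial $p$ among the $a_i$ and $b_j$ (separately for each index) fix a branch of $\log p$ on $\mathbb R^n_{>0}$, that is, a Borel function $\varphi_p$ with $\exp\varphi_p(x)=p(x)$ and $\varphi_p(rx)=\varphi_p(x)+\deg p\,\log r$ for all $r>0$ wherever $p(x)\ne0$, and with bounded imaginary part (for example the principal branch). Put $p(x)^s=e^{s\varphi_p(x)}$ where $p(x)\neq 0$, and $p(x)^s=0^s$ (that is, $1$ for $s=0$ and $0$ otherwise) where $p(x)=0$. Let $$I=\int_{\mathbb P^{n-1}_{>0}}\frac{\prod_i a_i(x)^{\nu_i}}{\prod_j b_j(x)^{\rho_j}}\,\Omega ,\qquad \Omega=\sum_{k=1}^n(-1)^{n-k}\frac{dx_1}{x_1}\wedge\dots\wedge\widehat{\frac{dx_k}{x_k}}\wedge\dots\wedge\frac{dx_n}{x_n},$$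 which in the chart $x_n=1$ is the integral over $\mathbb R^{n-1}_{>0}$ against $\prod_{k<n}dx_k/x_k$. For a polynomial $p=\sum_\ell c_\ell x^\ell$ let $\mathrm{NP}_p\subset\mathbb R^n$ be its Newton polytope and $p^{\mathrm{tr}}(x)=\max_{c_\ell\neq0}x^{\ell}$. Let $\mathcal A=\sum_i(\operatorname{Re}\nu_i)\mathrm{NP}_{a_i}$ and $\mathcal B=\sum_j(\operatorname{Re}\rho_j)\mathrm{NP}_{b_j}$ (Minkowski sums). Assume: * (R1) $\mathcal B$ is $(n-1)$-dimensional; * (R2) $\mathcal A$ is contained in the relative interior of $\mathcal B$; * (R3) every $b_j$ is completely non-vanishing on $\mathbb P^{n-1}_{>0}$: for each nonempty face $F$ of $\mathrm{NP}_{b_j}$, the truncation $\sum_{\ell\in F}c_\ell x^\ell$ of $b_j$ has no zero with all $x_k>0$. Let $\mathbb 1=(1,\dots,1)$. The normal cone of a polytope $P$ at a nonempty face $F$ is the set of $y\in\mathbb R^n$ such that $\langle y,\cdot\rangle$ attains its maximum over $P$ at every point of $F$; these cones form the normal fan of $P$. Let $\mathcal F_{\mathcal{AB}}/\mathbb 1\mathbb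 R$ be the image in $\mathbb R^n/\mathbb 1\mathbb R$ of the common refinement of the normal fans of $\mathcal A$ and $\mathcal B$. Let $\mathcal F^\Delta$ be any simplicial refinement of it, i.e. a finite fan of simplicial cones in $\mathbb R^n/\mathbb 1\mathbb R$ such that every cone of $\mathcal F_{\mathcal{AB}}/\mathbb 1\mathbb R$ is a union of cones of $\mathcal F^\Delta$, and let $\mathcal M$ be the set of cones of maximal dimension in $\mathcal F^\Delta$. For each $\mathcal C\in\mathcal M$ let $u^{(\mathcal C,1)},\dots,u^{(\mathcal C,n-1)}\in\mathbb R^n$ represent generators of $\mathcal C$, and let $w^{(\mathcal C)}=w_{\mathcal B}-w_{\mathcal A}$ with $w_{\mathcal A}\in\mathcal A$, $w_{\mathcal B}\in\mathcal B$ such that $\langle y,w_{\mathcal A}\rangle=\max_{v\in\mathcal A}\langle y,v\rangle$ and $\langle y,w_{\mathcal B}\rangle=\max_{v\in\mathcal B}\langle y,v\rangle$ for all $y\in\mathcal C$. For $N\ge1$ let $\xi^{(\mathcal C,\ell)}$ ($\mathcal C\in\mathcal M$, $1\le\ell\le N$) be independent random vectors, uniformly distributed on $[0,1]^{n-1}$,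 and let $$I^{(N)}=\sum_{\mathcal C\in\mathcal M}\frac1N\,\frac{|\det(u^{(\mathcal C,1)},\dots,u^{(\mathcal C,n-1)},\mathbb 1)|}{\prod_{k=1}^{n-1}\langle u^{(\mathcal C,k)},w^{(\mathcal C)}\rangle}\sum_{\ell=1}^N R_{a/b}\bigl(x^{(\mathcal C,\ell)}\bigr),\qquad x^{(\mathcal C,\ell)}_k=\prod_{i=1}^{n-1}\bigl(\xi^{(\mathcal C,\ell)}_i\bigr)^{-u^{(\mathcal C,i)}_k/\langle u^{(\mathcal C,i)},w^{(\mathcal C)}\rangle},$$ where $$R_{a/b}(x)=\frac{\prod_i a_i(x)^{\nu_i}/a_i^{\mathrm{tr}}(x)^{\operatorname{Re}\nu_i}}{\prod_j b_j(x)^{\rho_j}/b_j^{\mathrm{tr}}(x)^{\operatorname{Re}\rho_j}}.$$ Then the integral $I$ converges absolutely, the residual $R_{a/b}$ is bounded on $\mathbb P^{n-1}_{>0}$, and there is a constant $C\ge0$, independent of $N$, such that for every $N\ge1$ the complex random variable $I^{(N)}$ is square integrable with $$\mathbb E[I^{(N)}]=I\qquad\text{and}\qquad\mathbb E\bigl|I^{(N)}-\mathbb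 E[I^{(N)}]\bigr|^2=\frac CN .$$ -/

import Mathlib

open MeasureTheory ProbabilityTheory
open scoped Pointwise

noncomputable section

namespace EulerMellin

/-! ### Polynomials, Newton polytopes, tropical approximation -/

/-- The open positive orthant of `ℝⁿ`: homogeneous coordinates of the points of the
positive part of real projective space. -/
def posOrthant (n : ℕ) : Set (Fin n → ℝ) := {x | ∀ k, 0 < x k}

/-- The value of a complex polynomial at a real point. -/
def evalReal {n : ℕ} (p : MvPolynomial (Fin n) ℂ) (x : Fin n → ℝ) : ℂ :=
  MvPolynomial.eval (fun k => (x k : ℂ)) p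

/-- A multi-index, seen as a vector of `ℝⁿ`. -/
def expVec {n : ℕ} (l : Fin n →₀ ℕ) : Fin n → ℝ := fun k => (l k : ℝ)

/-- The Newton polytope of `p`. -/
def newtonPolytope {n : ℕ} (p : MvPolynomial (Fin n) ℂ) : Set (Fin n → ℝ) :=
  convexHull ℝ (expVec '' (p.support : Set (Fin n →₀ ℕ)))

/-- `F` is the face of `P` on which some linear functional is maximal. -/
def IsFace {n : ℕ} (P F : Set (Fin n → ℝ)) : Prop :=
  ∃ y : Fin n → ℝ, F = {v | v ∈ P ∧ ∀ w ∈ P, y ⬝ᵥ w ≤ y ⬝ᵥ v}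

open Classical in
/-- The truncated polynomial: the terms of `p` with exponent in `F`. -/
def truncation {n : ℕ} (p : MvPolynomial (Fin n) ℂ) (F : Set (Fin n → ℝ)) :
    MvPolynomial (Fin n) ℂ :=
  ∑ l ∈ p.support with expVec l ∈ F, MvPolynomial.monomial l (p.coeff l)

/-- `p` is completely non-vanishing on the positive orthant: no truncation of `p` to a
(non-empty) face of its Newton polytope has a zero there. -/
def CompletelyNonvanishing {n : ℕ} (p : MvPolynomial (Fin n) ℂ) : Prop :=
  ∀ F, IsFace (newtonPolytope p) F → F.Nonempty →
    ∀ x ∈ posOrthant n, evalReal (truncation p F) x ≠ 0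

/-- The tropical approximation: the largest monomial of `p` at `x`. -/
def trop {n : ℕ} (p : MvPolynomial (Fin n) ℂ) (x : Fin n → ℝ) : ℝ :=
  ⨆ l : p.support, ∏ k, x k ^ (l.1 k)

/-- `φ` is a branch of `log p` on the positive orthant: a Borel function with `exp φ = p` away
from the zeros of `p`, compatible with the scaling of homogeneous coordinates, and with bounded
argument. For a homogeneous polynomial the principal branch `fun x => Complex.log (p x)` is one;
so is every branch of the logarithm with a cut along a ray. -/
structure IsLogBranch {n : ℕ} (p : MvPolynomial (Fin n) ℂ) (φ : (Fin n → ℝ) → ℂ) : Prop where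
  measurable : Measurable φ
  exp_eq : ∀ x ∈ posOrthant n, evalReal p x ≠ 0 → Complex.exp (φ x) = evalReal p x
  scaling : ∀ x ∈ posOrthant n, evalReal p x ≠ 0 → ∀ r : ℝ, 0 < r →
    φ (r • x) = φ x + ((p.totalDegree * Real.log r : ℝ) : ℂ)
  bounded_arg : ∃ M : ℝ, ∀ x ∈ posOrthant n, |(φ x).im| ≤ M

open Classical in
/-- The power `p(x)^s` taken with the branch `φ` of `log p`. (At a zero of `p` it is `0 ^ s`, that
is, `0` for `s ≠ 0` and `1` for `s = 0`.) -/
def branchPow {n : ℕ} (p : MvPolynomial (Fin n) ℂ) (φ : (Fin n → ℝ) → ℂ) (s : ℂ)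
    (x : Fin n → ℝ) : ℂ :=
  if evalReal p x = 0 then (0 : ℂ) ^ s else Complex.exp (s * φ x)

/-! ### The integral -/

/-- The integrand `∏ aᵢ(x)^νᵢ / ∏ bⱼ(x)^ρⱼ`. -/
def integrand {n : ℕ} {ι κ : Type*} [Fintype ι] [Fintype κ]
    (a : ι → MvPolynomial (Fin n) ℂ) (b : κ → MvPolynomial (Fin n) ℂ)
    (ν : ι → ℂ) (ρ : κ → ℂ) (α : ι → (Fin n → ℝ) → ℂ) (β : κ → (Fin n → ℝ) → ℂ)
    (x : Fin n → ℝ) : ℂ :=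
  (∏ i, branchPow (a i) (α i) (ν i) x) / ∏ j, branchPow (b j) (β j) (ρ j) x

/-- The residual `R_{a/b}`. -/
def residual {n : ℕ} {ι κ : Type*} [Fintype ι] [Fintype κ]
    (a : ι → MvPolynomial (Fin n) ℂ) (b : κ → MvPolynomial (Fin n) ℂ)
    (ν : ι → ℂ) (ρ : κ → ℂ) (α : ι → (Fin n → ℝ) → ℂ) (β : κ → (Fin n → ℝ) → ℂ)
    (x : Fin n → ℝ) : ℂ :=
  (∏ i, branchPow (a i) (α i) (ν i) x / ((trop (a i) x ^ (ν i).re : ℝ) : ℂ)) /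
    ∏ j, branchPow (b j) (β j) (ρ j) x / ((trop (b j) x ^ (ρ j).re : ℝ) : ℂ)

/-- The measure given by the canonical form `Ω` on the positive part of projective `d`-space,
`n = d + 1`, in the chart `x_n = 1`: there `Ω` is `∏ dx_k / x_k` over `k < n`, on the positive
orthant of `ℝ^d`. -/
def canonicalMeasure (d : ℕ) : Measure (Fin d → ℝ) :=
  (volume.restrict (posOrthant d)).withDensity fun x => ENNReal.ofReal (∏ k, (x k)⁻¹)

/-- The point `[x_1 : … : x_d : 1]`. -/
def chart {d : ℕ} (x : Fin d → ℝ) : Fin (d + 1) → ℝ :=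
  Fin.snoc (α := fun _ => ℝ) x 1

/-- The weighted Minkowski sum of the Newton polytopes of the `pᵢ` with weights `Re sᵢ`. -/
def weightedNewtonPolytope {n : ℕ} {ι : Type*} [Fintype ι]
    (p : ι → MvPolynomial (Fin n) ℂ) (s : ι → ℂ) : Set (Fin n → ℝ) :=
  ∑ i, (s i).re • newtonPolytope (p i)

/-! ### Cones and fans -/

section Cones

variable {V : Type*} [AddCommGroup V] [Module ℝ V]

/-- The cone generated by a finite family of vectors. -/
def coneSpan {m : ℕ} (u : Fin m → V) : Set V :=
  {y | ∃ c : Fin m → ℝ, (∀ k, 0 ≤ c k) ∧ y = ∑ k, c k • u k}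

/-- `F` is a face of the cone `C`. -/
def IsConeFace (C F : Set V) : Prop :=
  ∃ f : V →ₗ[ℝ] ℝ, (∀ y ∈ C, f y ≤ 0) ∧ F = {y | y ∈ C ∧ f y = 0}

/-- A fan: finitely many polyhedral cones, closed under taking faces, any two of which meet in a
common face. -/
structure IsFan (𝓕 : Set (Set V)) : Prop where
  finite : 𝓕.Finite
  polyhedral : ∀ C ∈ 𝓕, ∃ (m : ℕ) (u : Fin m → V), C = coneSpan u
  face_mem : ∀ C ∈ 𝓕, ∀ F, IsConeFace C F → F ∈ 𝓕
  inter_face : ∀ C ∈ 𝓕, ∀ C' ∈ 𝓕, IsConeFace C (C ∩ C') ∧ IsConeFace C' (C ∩ C')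

/-- A simplicial cone: generated by linearly independent vectors. -/
def IsSimplicialCone (C : Set V) : Prop :=
  ∃ (m : ℕ) (u : Fin m → V), LinearIndependent ℝ u ∧ C = coneSpan u

/-- `𝓖` refines `𝓕`: every cone of `𝓕` is a union of cones of `𝓖`. -/
def Refines (𝓖 𝓕 : Set (Set V)) : Prop :=
  ∀ C ∈ 𝓕, ∃ 𝓢 ⊆ 𝓖, C = ⋃₀ 𝓢

/-- The dimension of a cone. -/
def coneDim (C : Set V) : ℕ := Module.finrank ℝ (Submodule.span ℝ C)

open Classical in
/-- The cones of maximal dimension. -/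
def maximalCones (𝓕 : Finset (Set V)) : Finset (Set V) :=
  {C ∈ 𝓕 | ∀ C' ∈ 𝓕, coneDim C' ≤ coneDim C}

end Cones

/-- The normal cone of the polytope `P` at `F`. -/
def normalCone {n : ℕ} (P F : Set (Fin n → ℝ)) : Set (Fin n → ℝ) :=
  {y | ∀ v ∈ F, ∀ w ∈ P, y ⬝ᵥ w ≤ y ⬝ᵥ v}

/-- The normal fan of the polytope `P`. -/
def normalFan {n : ℕ} (P : Set (Fin n → ℝ)) : Set (Set (Fin n → ℝ)) :=
  {C | ∃ F, IsFace P F ∧ F.Nonempty ∧ C = normalCone P F}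

/-- The common refinement of two fans. -/
def commonRefinement {n : ℕ} (𝓕 𝓖 : Set (Set (Fin n → ℝ))) : Set (Set (Fin n → ℝ)) :=
  {C | ∃ C₁ ∈ 𝓕, ∃ C₂ ∈ 𝓖, C = C₁ ∩ C₂}

/-- Tropical projective space, the quotient of `ℝⁿ` by the line through `(1, …, 1)`. -/
abbrev TropSpace (n : ℕ) : Type :=
  (Fin n → ℝ) ⧸ Submodule.span ℝ {(1 : Fin n → ℝ)}

/-- The class of a vector in tropical projective space. -/
def toTrop {n : ℕ} (y : Fin n → ℝ) : TropSpace n :=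
  (Submodule.span ℝ {(1 : Fin n → ℝ)}).mkQ y

/-- The reduced common refinement of the normal fans of `A` and `B`. -/
def reducedCommonFan {n : ℕ} (A B : Set (Fin n → ℝ)) : Set (Set (TropSpace n)) :=
  {C | ∃ C₀ ∈ commonRefinement (normalFan A) (normalFan B), C = toTrop '' C₀}

/-- `𝓕` is a simplicial refinement of the reduced common normal fan of `A` and `B`. -/
structure IsSimplicialRefinement {n : ℕ} (A B : Set (Fin n → ℝ))
    (𝓕 : Finset (Set (TropSpace n))) : Prop where
  isFan : IsFan (𝓕 : Set (Set (TropSpace n)))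
  refines : Refines (𝓕 : Set (Set (TropSpace n))) (reducedCommonFan A B)
  simplicial : ∀ C ∈ 𝓕, IsSimplicialCone C

/-! ### The sampling algorithm -/

/-- The table used by the algorithm: for each maximal cone `C` representatives `u C k` in `ℝⁿ` of
generators of `C`, and `w C = w_B - w_A`, where `w_A ∈ A` and `w_B ∈ B` maximize every functional
of `C` on `A` and on `B`. -/
structure IsSectorTable {d : ℕ} (A B : Set (Fin (d + 1) → ℝ))
    (𝓕 : Finset (Set (TropSpace (d + 1))))
    (u : maximalCones 𝓕 → Fin d → Fin (d + 1) → ℝ)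
    (w : maximalCones 𝓕 → Fin (d + 1) → ℝ) : Prop where
  generators : ∀ C : maximalCones 𝓕, (C : Set (TropSpace (d + 1))) =
    coneSpan fun k => toTrop (u C k)
  weights : ∀ C : maximalCones 𝓕, ∃ wA ∈ A, ∃ wB ∈ B, w C = wB - wA ∧
    ∀ y, toTrop y ∈ (C : Set (TropSpace (d + 1))) →
      (∀ v ∈ A, y ⬝ᵥ v ≤ y ⬝ᵥ wA) ∧ (∀ v ∈ B, y ⬝ᵥ v ≤ y ⬝ᵥ wB)

/-- The prefactor `|det(u₁, …, u_d, 𝟙)| / ∏ ⟨u_k, w⟩` of a sector. -/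
def sectorPrefactor {d : ℕ} (u : Fin d → Fin (d + 1) → ℝ) (w : Fin (d + 1) → ℝ) : ℝ :=
  |(Matrix.of (Fin.snoc (α := fun _ => Fin (d + 1) → ℝ) u 1)).det| / ∏ k, u k ⬝ᵥ w

/-- The point `x_k(ξ) = ∏ᵢ ξᵢ ^ (-u_k⁽ⁱ⁾ / ⟨u⁽ⁱ⁾, w⟩)` of a sector. -/
def sectorPoint {d : ℕ} (u : Fin d → Fin (d + 1) → ℝ) (w : Fin (d + 1) → ℝ)
    (ξ : Fin d → ℝ) : Fin (d + 1) → ℝ :=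
  fun k => ∏ i, ξ i ^ (-(u i k) / (u i ⬝ᵥ w))

/-- The value returned by the basic sector-wise Monte Carlo algorithm for the function `f`, as a
function of the drawn vectors `ξ C l`, `C` a maximal cone and `l = 1, …, N`. -/
def basicEstimator {d N : ℕ} {𝓕 : Finset (Set (TropSpace (d + 1)))}
    (u : maximalCones 𝓕 → Fin d → Fin (d + 1) → ℝ) (w : maximalCones 𝓕 → Fin (d + 1) → ℝ)
    (f : (Fin (d + 1) → ℝ) → ℂ) (ξ : maximalCones 𝓕 → Fin N → Fin d → ℝ) : ℂ :=
  ∑ C, (1 / (N : ℂ)) * (sectorPrefactor (u C) (w C) : ℂ) *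
    ∑ l, f (sectorPoint (u C) (w C) (ξ C l))

/-- The variance `E|X - E X|²` of a complex random variable. -/
def complexVariance {Ω : Type*} [MeasurableSpace Ω] (X : Ω → ℂ) (P : Measure Ω) : ℝ :=
  ∫ ω, ‖X ω - ∫ ω', X ω' ∂P‖ ^ 2 ∂P

end EulerMellin

end

open EulerMellin

namespace EulerMellin

open Filter Topology

/-! ### Monomials and the tropical approximation -/

/-! In logarithmic coordinates `Ω` is Lebesgue measure on `ℝⁿ / 𝟙ℝ`, to which the integrand descends
because its total degree is zero. The integrand is the residual times `∏ trop(aᵢ)^Re νᵢ / ∏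
trop(bⱼ)^Re ρⱼ`, and this tropical factor is the exponential of the support function of `𝒜` minus
that of `ℬ`. Both are linear on a cone of the refinement, so there the factor is `exp(-⟨y, w⟩)`.
Writing `y = ∑ tᵢ uᵢ` with `tᵢ = -log ξᵢ / ⟨uᵢ, w⟩` turns the cone into the unit cube and the factor
into `∏ ξᵢ`, while the Jacobian is the sector prefactor divided by `∏ ξᵢ`. The two products cancel,
so `I` is the sum over sectors of the prefactor times the mean of the residual over the cube. The
estimator is then a stratified Monte Carlo sum for bounded functions, and independence gives its
mean and variance.

Three facts carry this. The exponents `⟨uᵢ, w⟩` are positive (`dotProduct_sub_pos`), by (R1) and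
(R2). The residual is bounded (`exists_norm_residual_le`): the triangle inequality bounds the
numerators, a compactness argument based on (R3) bounds the denominators from below
(`CompletelyNonvanishing.exists_le`), and the bounded argument of each branch controls the imaginary
exponents. Finally, the maximal cones tile the space up to null sets
(`iUnion_maximalCones_ae_eq_univ`, `IsFan.aedisjoint`). -/

theorem prod_pow_pos {n : ℕ} {x : Fin n → ℝ} (hx : x ∈ posOrthant n) (l : Fin n →₀ ℕ) :
    0 < ∏ k, x k ^ l k :=
  Finset.prod_pos fun k _ => pow_pos (hx k) _

theorem prod_exp_pow {n : ℕ} (y : Fin n → ℝ) (l : Fin n →₀ ℕ) :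
    ∏ k, Real.exp (y k) ^ l k = Real.exp (y ⬝ᵥ expVec l) := by
  simp only [dotProduct, expVec, Real.exp_sum]
  refine Finset.prod_congr rfl fun k _ => ?_
  rw [← Real.exp_nat_mul, mul_comm]

theorem le_trop {n : ℕ} (p : MvPolynomial (Fin n) ℂ) (x : Fin n → ℝ) {l : Fin n →₀ ℕ}
    (hl : l ∈ p.support) : ∏ k, x k ^ l k ≤ trop p x :=
  le_ciSup (f := fun l : p.support => ∏ k, x k ^ (l.1 k)) (Set.finite_range _).bddAbove ⟨l, hl⟩

theorem exists_trop_eq {n : ℕ} {p : MvPolynomial (Fin n) ℂ} (hp : p ≠ 0) (x : Fin n → ℝ) :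
    ∃ l ∈ p.support, trop p x = ∏ k, x k ^ l k := by
  have : Nonempty p.support := by
    obtain ⟨l, hl⟩ := MvPolynomial.support_nonempty.2 hp
    exact ⟨⟨l, hl⟩⟩
  obtain ⟨l, hl⟩ := exists_eq_ciSup_of_finite (f := fun l : p.support => ∏ k, x k ^ (l.1 k))
  exact ⟨l.1, l.2, hl.symm⟩

theorem trop_pos {n : ℕ} {p : MvPolynomial (Fin n) ℂ} (hp : p ≠ 0) {x : Fin n → ℝ}
    (hx : x ∈ posOrthant n) : 0 < trop p x := by
  obtain ⟨l, -, h⟩ := exists_trop_eq hp x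
  rw [h]
  exact prod_pow_pos hx l

theorem evalReal_eq_sum {n : ℕ} (p : MvPolynomial (Fin n) ℂ) (x : Fin n → ℝ) :
    evalReal p x = ∑ l : p.support, p.coeff l.1 * ((∏ k, x k ^ (l.1 k) : ℝ) : ℂ) := by
  rw [evalReal, MvPolynomial.eval_eq', ← Finset.sum_coe_sort]
  simp

theorem norm_evalReal_le {n : ℕ} (p : MvPolynomial (Fin n) ℂ) {x : Fin n → ℝ}
    (hx : x ∈ posOrthant n) :
    ‖evalReal p x‖ ≤ (∑ l : p.support, ‖p.coeff l.1‖) * trop p x := by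
  rw [evalReal_eq_sum, Finset.sum_mul]
  refine (norm_sum_le _ _).trans (Finset.sum_le_sum fun l _ => ?_)
  rw [norm_mul, Complex.norm_real, Real.norm_of_nonneg (prod_pow_pos hx _).le]
  exact mul_le_mul_of_nonneg_left (le_trop p x l.2) (norm_nonneg _)

/-! ### The lower bound for completely non-vanishing polynomials -/

/-- Limits of the exponentials of points of a linear space: on the coordinates with positive limit
the limit is itself attained, and these coordinates form a face. -/
theorem exists_of_tendsto_exp {E σ : Type*} [AddCommGroup E] [Module ℝ E] [Finite σ]
    (T : E →ₗ[ℝ] (σ → ℝ)) (v : ℕ → E) (r : σ → ℝ)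
    (h : ∀ l, Tendsto (fun m => Real.exp (T (v m) l)) atTop (𝓝 (r l))) :
    ∃ z y : E, ∀ l, (0 < r l → T y l = 0 ∧ Real.exp (T z l) = r l) ∧ (r l = 0 → T y l < 0) := by
  classical
  cases nonempty_fintype σ
  let R : (σ → ℝ) →ₗ[ℝ] ({l // 0 < r l} → ℝ) := LinearMap.funLeft ℝ ℝ Subtype.val
  let TF := R ∘ₗ T
  -- A section of `TF` on its range, extended to a linear map `S` on the whole target, satisfies `TF
  -- ∘ S ∘ TF = TF`.
  obtain ⟨g, hg⟩ := TF.rangeRestrict.exists_rightInverse_of_surjective TF.range_rangeRestrict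
  obtain ⟨S, hS⟩ := LinearMap.exists_extend g
  have key : ∀ e, TF (S (TF e)) = TF e := by
    intro e
    have h1 : S (TF e) = g (TF.rangeRestrict e) := by rw [← hS]; rfl
    have h2 := LinearMap.congr_fun hg (TF.rangeRestrict e)
    rw [h1]
    exact congrArg Subtype.val h2
  let ℓ : {l // 0 < r l} → ℝ := fun l => Real.log (r l)
  have hℓ : Tendsto (fun m => TF (v m)) atTop (𝓝 ℓ) := by
    refine tendsto_pi_nhds.2 fun l => ?_
    have := (h l.1).log l.2.ne'
    simp only [Real.log_exp] at this
    exact this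
  -- `TF ∘ S` fixes every point of the range of `TF` and is continuous, so it fixes the limit `ℓ` as
  -- well.
  have hz : TF (S ℓ) = ℓ := by
    have h1 : Tendsto (fun m => (TF ∘ₗ S) (TF (v m))) atTop (𝓝 ((TF ∘ₗ S) ℓ)) :=
      ((LinearMap.continuous_of_finiteDimensional (TF ∘ₗ S)).tendsto ℓ).comp hℓ
    refine tendsto_nhds_unique h1 ?_
    simpa [key] using hℓ
  -- On the vanishing coordinates `T (v m)` tends to `-∞` while the correction converges. One late
  -- `m` therefore makes `v m - S (TF (v m))` negative on all of them, and it is zero on the others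
  -- by `key`.
  have hneg : ∀ᶠ m in atTop, ∀ l, r l = 0 → T (v m) l - T (S (TF (v m))) l < 0 := by
    refine eventually_all.2 fun l => ?_
    by_cases hl : r l = 0
    · have h1 : Tendsto (fun m => T (v m) l) atTop atBot := by
        have := h l
        rw [hl] at this
        exact Real.tendsto_exp_comp_nhds_zero.1 this
      have h2 : Tendsto (fun m => (T ∘ₗ S) (TF (v m)) l) atTop (𝓝 ((T ∘ₗ S) ℓ l)) :=
        ((((continuous_apply l).comp
          (LinearMap.continuous_of_finiteDimensional (T ∘ₗ S))).tendsto ℓ).comp hℓ)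
      have h3 := (h1.atBot_add h2.neg).eventually_lt_atBot 0
      filter_upwards [h3] with m hm _
      simpa [sub_eq_add_neg] using hm
    · exact Eventually.of_forall fun m h0 => absurd h0 hl
  obtain ⟨m, hm⟩ := hneg.exists
  refine ⟨S ℓ, v m - S (TF (v m)), fun l => ⟨fun hl => ⟨?_, ?_⟩, fun hl => ?_⟩⟩
  · have := congrFun (key (v m)) ⟨l, hl⟩
    rw [map_sub, Pi.sub_apply, sub_eq_zero]
    exact this.symm
  · have : T (S ℓ) l = Real.log (r l) := congrFun hz ⟨l, hl⟩
    rw [this, Real.exp_log hl]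
  · rw [map_sub]
    exact hm l hl

theorem dotProduct_le_of_mem_newtonPolytope {n : ℕ} {p : MvPolynomial (Fin n) ℂ}
    {y : Fin n → ℝ} {s : ℝ} (h : ∀ l ∈ p.support, y ⬝ᵥ expVec l ≤ s) {v : Fin n → ℝ}
    (hv : v ∈ newtonPolytope p) : y ⬝ᵥ v ≤ s := by
  have hc : Convex ℝ {v : Fin n → ℝ | y ⬝ᵥ v ≤ s} := by
    have : IsLinearMap ℝ fun v : Fin n → ℝ => y ⬝ᵥ v :=
      ⟨fun a b => dotProduct_add _ _ _, fun c a => by simp⟩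
    exact convex_halfSpace_le this s
  refine convexHull_min ?_ hc hv
  rintro _ ⟨l, hl, rfl⟩
  exact h l hl

theorem expVec_mem_newtonPolytope {n : ℕ} {p : MvPolynomial (Fin n) ℂ} {l : Fin n →₀ ℕ}
    (hl : l ∈ p.support) : expVec l ∈ newtonPolytope p :=
  subset_convexHull _ _ ⟨l, hl, rfl⟩

theorem evalReal_truncation {n : ℕ} (p : MvPolynomial (Fin n) ℂ) (F : Set (Fin n → ℝ))
    (x : Fin n → ℝ) [DecidablePred fun l : p.support => expVec l.1 ∈ F] :
    evalReal (truncation p F) x =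
      ∑ l : p.support, if expVec l.1 ∈ F then p.coeff l.1 * ((∏ k, x k ^ (l.1 k) : ℝ) : ℂ)
        else 0 := by
  classical
  rw [evalReal, truncation, map_sum, Finset.sum_filter, ← Finset.sum_coe_sort]
  refine Finset.sum_congr rfl fun l _ => ?_
  by_cases h : expVec l.1 ∈ F
  · simp [h, MvPolynomial.eval_monomial, Finsupp.prod_fintype]
  · simp [h]

/-- Suppose `|p| / trop p` comes arbitrarily close to `0`. The monomials divided by `trop p` lie in
a compact cube, so along a subsequence they converge. The exponents with positive limit are those of
a face of the Newton polytope, and their limits are, up to a common factor, the monomial values at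
an actual point of the orthant. The truncation to that face vanishes there, against complete
non-vanishing. -/
theorem CompletelyNonvanishing.exists_le {n : ℕ} {p : MvPolynomial (Fin n) ℂ} (hp : p ≠ 0)
    (h : CompletelyNonvanishing p) :
    ∃ c : ℝ, 0 < c ∧ ∀ x ∈ posOrthant n, c * trop p x ≤ ‖evalReal p x‖ := by
  classical
  by_contra! hcon
  choose x hx hlt using fun m : ℕ => hcon (1 / ((m : ℝ) + 1)) (by positivity)
  let q : ℕ → p.support → ℝ := fun m l => (∏ k, x m k ^ (l.1 k)) / trop p (x m)
  have hq : ∀ m, q m ∈ Set.Icc (0 : p.support → ℝ) 1 := fun m =>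
    ⟨fun l => div_nonneg (prod_pow_pos (hx m) _).le (trop_pos hp (hx m)).le,
      fun l => (div_le_one (trop_pos hp (hx m))).2 (le_trop p _ l.2)⟩
  obtain ⟨r, hr, φ, hφ, hlim⟩ := isCompact_Icc.tendsto_subseq hq
  have hliml := tendsto_pi_nhds.1 hlim
  -- The extra real coordinate holds `log (trop p x)`, which makes the normalised monomials
  -- exponentials of linear forms.
  let T : ((Fin n → ℝ) × ℝ) →ₗ[ℝ] (p.support → ℝ) :=
    { toFun := fun e l => e.1 ⬝ᵥ expVec l.1 - e.2
      map_add' := fun e f => by ext l; simp [add_dotProduct]; ring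
      map_smul' := fun c e => by ext l; simp [smul_dotProduct]; ring }
  let v : ℕ → (Fin n → ℝ) × ℝ := fun m =>
    (fun k => Real.log (x (φ m) k), Real.log (trop p (x (φ m))))
  have hv : ∀ m l, Real.exp (T (v m) l) = q (φ m) l := by
    intro m l
    have h1 : T (v m) l = (fun k => Real.log (x (φ m) k)) ⬝ᵥ expVec l.1
      - Real.log (trop p (x (φ m))) := rfl
    rw [h1, Real.exp_sub, Real.exp_log (trop_pos hp (hx _)), ← prod_exp_pow]
    simp only [q]
    congr 1
    exact Finset.prod_congr rfl fun k _ => by rw [Real.exp_log (hx _ k)]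
  obtain ⟨z, y, hzy⟩ := exists_of_tendsto_exp T v r (fun l => by simpa [hv] using hliml l)
  -- The largest normalised monomial equals `1`, so the sum of all of them stays at least `1` in the
  -- limit.
  have hone : ∃ l0, 0 < r l0 := by
    by_contra! hle
    have hr0 : ∀ l, r l = 0 := fun l => le_antisymm (hle l) (hr.1 l)
    have hs : Tendsto (fun m => ∑ l, q (φ m) l) atTop (𝓝 (∑ l, r l)) :=
      tendsto_finsetSum _ fun l _ => hliml l
    have : (1 : ℝ) ≤ ∑ l, r l := by
      refine ge_of_tendsto' hs fun m => ?_
      obtain ⟨l, hl, he⟩ := exists_trop_eq hp (x (φ m))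
      have h1 : q (φ m) ⟨l, hl⟩ = 1 := by
        simp only [q]
        rw [← he, div_self (trop_pos hp (hx _)).ne']
      rw [← h1]
      exact Finset.single_le_sum (f := fun l => q (φ m) l) (fun l _ => (hq (φ m)).1 l)
        (Finset.mem_univ _)
    simp [hr0] at this
    linarith
  obtain ⟨l0, hl0⟩ := hone
  -- The functional `y.1` is at most `y.2` on the polytope, and among the exponents of `p` equality
  -- holds exactly for those with positive limit.
  let F : Set (Fin n → ℝ) :=
    {v | v ∈ newtonPolytope p ∧ ∀ w ∈ newtonPolytope p, y.1 ⬝ᵥ w ≤ y.1 ⬝ᵥ v}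
  have hTy : ∀ l, T y l = y.1 ⬝ᵥ expVec l.1 - y.2 := fun l => rfl
  have hle : ∀ w ∈ newtonPolytope p, y.1 ⬝ᵥ w ≤ y.2 := fun w hw => by
    refine dotProduct_le_of_mem_newtonPolytope (fun l hl => ?_) hw
    rcases (hr.1 ⟨l, hl⟩).eq_or_lt with h0 | h0
    · have := (hzy ⟨l, hl⟩).2 h0.symm
      rw [hTy] at this
      linarith
    · have := ((hzy ⟨l, hl⟩).1 h0).1
      rw [hTy] at this
      linarith
  have hpos : ∀ l : p.support, 0 < r l → expVec l.1 ∈ F := fun l hl => by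
    refine ⟨expVec_mem_newtonPolytope l.2, fun w hw => (hle w hw).trans ?_⟩
    have := ((hzy l).1 hl).1
    rw [hTy] at this
    linarith
  have hzero : ∀ l : p.support, expVec l.1 ∈ F → 0 < r l := fun l hl => by
    refine (hr.1 l).lt_of_ne fun h0 => ?_
    have h1 := (hzy l).2 h0.symm
    have h2 := ((hzy l0).1 hl0).1
    have h3 := hl.2 _ (expVec_mem_newtonPolytope l0.2)
    rw [hTy] at h1 h2
    linarith
  have hne := h F ⟨y.1, rfl⟩ ⟨_, hpos l0 hl0⟩ (fun k => Real.exp (z.1 k)) fun k => Real.exp_pos _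
  apply hne
  have h1 : evalReal (truncation p F) (fun k => Real.exp (z.1 k)) =
      (Real.exp z.2 : ℂ) * ∑ l : p.support, p.coeff l.1 * (r l : ℂ) := by
    rw [evalReal_truncation, Finset.mul_sum]
    refine Finset.sum_congr rfl fun l _ => ?_
    split_ifs with hl
    · have h2 := ((hzy l).1 (hzero l hl)).2
      have h3 : T z l = z.1 ⬝ᵥ expVec l.1 - z.2 := rfl
      rw [prod_exp_pow, ← h2, h3, Real.exp_sub]
      push_cast
      field_simp
    · have : r l = 0 := le_antisymm (not_lt.1 fun h0 => hl (hpos l h0)) (hr.1 l)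
      simp [this]
  have h2 : Tendsto (fun m => ∑ l : p.support, p.coeff l.1 * (q (φ m) l : ℂ)) atTop
      (𝓝 (∑ l : p.support, p.coeff l.1 * (r l : ℂ))) :=
    tendsto_finsetSum _ fun l _ => ((Complex.continuous_ofReal.tendsto _).comp (hliml l)).const_mul _
  have h3 : Tendsto (fun m => ∑ l : p.support, p.coeff l.1 * (q (φ m) l : ℂ)) atTop (𝓝 0) := by
    have h4 : Tendsto (fun m => 1 / ((φ m : ℝ) + 1)) atTop (𝓝 0) :=
      tendsto_one_div_add_atTop_nhds_zero_nat.comp hφ.tendsto_atTop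
    refine squeeze_zero_norm (fun m => ?_) h4
    have h5 : ∑ l : p.support, p.coeff l.1 * (q (φ m) l : ℂ) =
        evalReal p (x (φ m)) / (trop p (x (φ m)) : ℂ) := by
      rw [evalReal_eq_sum, Finset.sum_div]
      refine Finset.sum_congr rfl fun l _ => ?_
      simp only [q]
      push_cast
      ring
    have htp := trop_pos hp (hx (φ m))
    rw [h5, norm_div, Complex.norm_real, Real.norm_of_nonneg htp.le, div_le_iff₀ htp]
    exact (hlt (φ m)).le
  rw [h1, tendsto_nhds_unique h2 h3, mul_zero]

/-! ### Powers along a branch of the logarithm -/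

theorem norm_branchPow {n : ℕ} {p : MvPolynomial (Fin n) ℂ} {φ : (Fin n → ℝ) → ℂ}
    (hφ : IsLogBranch p φ) (s : ℂ) {x : Fin n → ℝ} (hx : x ∈ posOrthant n)
    (h : evalReal p x ≠ 0) :
    ‖branchPow p φ s x‖ = ‖evalReal p x‖ ^ s.re * Real.exp (-(s.im * (φ x).im)) := by
  rw [branchPow, if_neg h, Complex.norm_exp, ← hφ.exp_eq x hx h, Complex.norm_exp,
    ← Real.exp_mul, ← Real.exp_add, Complex.mul_re]
  congr 1
  ring

theorem exists_norm_branchPow_div_le {n : ℕ} {p : MvPolynomial (Fin n) ℂ} (hp : p ≠ 0)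
    {φ : (Fin n → ℝ) → ℂ} (hφ : IsLogBranch p φ) {s : ℂ} (hs : 0 ≤ s.re) :
    ∃ K : ℝ, ∀ x ∈ posOrthant n, ‖branchPow p φ s x / ((trop p x ^ s.re : ℝ) : ℂ)‖ ≤ K := by
  obtain ⟨M, hM⟩ := hφ.bounded_arg
  set S := ∑ l : p.support, ‖p.coeff l.1‖ with hS
  have hS0 : 0 ≤ S := Finset.sum_nonneg fun _ _ => norm_nonneg _
  -- The `1` covers the zeros of `p`, where the power is `0` or, for `s = 0`, equal to `1`.
  refine ⟨max 1 (S ^ s.re * Real.exp (|s.im| * M)), fun x hx => ?_⟩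
  have ht := trop_pos hp hx
  have htr : 0 < trop p x ^ s.re := Real.rpow_pos_of_pos ht _
  rw [norm_div, Complex.norm_real, Real.norm_of_nonneg htr.le]
  by_cases h : evalReal p x = 0
  · refine le_max_of_le_left ?_
    rw [branchPow, if_pos h]
    by_cases h0 : s = 0
    · simp [h0]
    · simp [Complex.zero_cpow h0]
  · refine le_max_of_le_right ?_
    rw [norm_branchPow hφ s hx h, div_le_iff₀ htr]
    calc ‖evalReal p x‖ ^ s.re * Real.exp (-(s.im * (φ x).im))
        ≤ (S * trop p x) ^ s.re * Real.exp (|s.im| * M) := by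
          gcongr
          · exact norm_evalReal_le p hx
          · refine (neg_le_abs _).trans ?_
            rw [abs_mul]
            exact mul_le_mul_of_nonneg_left (hM x hx) (abs_nonneg _)
      _ = _ := by rw [Real.mul_rpow hS0 ht.le]; ring

/-- The lower bound by `c * trop p` also excludes zeros of `p`, so the exponential formula for the
norm applies everywhere. -/
theorem exists_norm_inv_branchPow_div_le {n : ℕ} {p : MvPolynomial (Fin n) ℂ} (hp : p ≠ 0)
    {φ : (Fin n → ℝ) → ℂ} (hφ : IsLogBranch p φ) (hc : CompletelyNonvanishing p) {s : ℂ}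
    (hs : 0 ≤ s.re) :
    ∃ K : ℝ, ∀ x ∈ posOrthant n, ‖(branchPow p φ s x / ((trop p x ^ s.re : ℝ) : ℂ))⁻¹‖ ≤ K := by
  obtain ⟨M, hM⟩ := hφ.bounded_arg
  obtain ⟨c, hc0, hc⟩ := hc.exists_le hp
  refine ⟨(c ^ s.re * Real.exp (-(|s.im| * M)))⁻¹, fun x hx => ?_⟩
  have ht := trop_pos hp hx
  have htr : 0 < trop p x ^ s.re := Real.rpow_pos_of_pos ht _
  have hpos : 0 < ‖evalReal p x‖ := (mul_pos hc0 ht).trans_le (hc x hx)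
  rw [norm_inv, norm_div, Complex.norm_real, Real.norm_of_nonneg htr.le,
    norm_branchPow hφ s hx (norm_pos_iff.1 hpos)]
  refine inv_anti₀ (mul_pos (Real.rpow_pos_of_pos hc0 _) (Real.exp_pos _)) ?_
  rw [le_div_iff₀ htr]
  calc c ^ s.re * Real.exp (-(|s.im| * M)) * trop p x ^ s.re
      = (c * trop p x) ^ s.re * Real.exp (-(|s.im| * M)) := by
        rw [Real.mul_rpow hc0.le ht.le]; ring
    _ ≤ _ := by
        have hle : s.im * (φ x).im ≤ |s.im| * M := by
          refine (le_abs_self _).trans ?_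
          rw [abs_mul]
          exact mul_le_mul_of_nonneg_left (hM x hx) (abs_nonneg _)
        exact mul_le_mul (Real.rpow_le_rpow (mul_pos hc0 ht).le (hc x hx) hs)
          (Real.exp_le_exp.2 (neg_le_neg hle)) (Real.exp_pos _).le (by positivity)

theorem evalReal_smul {n : ℕ} {p : MvPolynomial (Fin n) ℂ} {D : ℕ} (hp : p.IsHomogeneous D)
    (r : ℝ) (x : Fin n → ℝ) : evalReal p (r • x) = (r : ℂ) ^ D * evalReal p x := by
  rw [evalReal_eq_sum, evalReal_eq_sum, Finset.mul_sum]
  refine Finset.sum_congr rfl fun l _ => ?_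
  have hD : ∑ k, l.1 k = D := by
    have := hp (MvPolynomial.mem_support_iff.1 l.2)
    rw [← this, Finsupp.weight_apply, Finsupp.sum_fintype] <;> simp
  simp only [Pi.smul_apply, smul_eq_mul, mul_pow, Finset.prod_mul_distrib, Finset.prod_pow_eq_pow_sum, hD]
  push_cast
  ring

theorem branchPow_smul {n : ℕ} {p : MvPolynomial (Fin n) ℂ} (hp : p.IsHomogeneous p.totalDegree)
    {φ : (Fin n → ℝ) → ℂ} (hφ : IsLogBranch p φ) (s : ℂ) {x : Fin n → ℝ} (hx : x ∈ posOrthant n)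
    {r : ℝ} (hr : 0 < r) :
    branchPow p φ s (r • x) =
      branchPow p φ s x * Complex.exp (s * p.totalDegree * (Real.log r : ℝ)) := by
  have hr' : (r : ℂ) ^ p.totalDegree ≠ 0 := pow_ne_zero _ (by exact_mod_cast hr.ne')
  by_cases h : evalReal p x = 0
  · have h' : evalReal p (r • x) = 0 := by rw [evalReal_smul hp, h, mul_zero]
    rw [branchPow, branchPow, if_pos h, if_pos h']
    by_cases h0 : s = 0
    · simp [h0]
    · simp [Complex.zero_cpow h0]
  · have h' : evalReal p (r • x) ≠ 0 := by
      rw [evalReal_smul hp]; exact mul_ne_zero hr' h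
    rw [branchPow, branchPow, if_neg h, if_neg h', hφ.scaling x hx h r hr, ← Complex.exp_add]
    congr 1
    push_cast
    ring

section Families

variable {n : ℕ} {ι κ : Type*} [Fintype ι] [Fintype κ]

/-- The integrand is invariant under rescaling of the homogeneous coordinates. -/
theorem integrand_smul {a : ι → MvPolynomial (Fin n) ℂ} {b : κ → MvPolynomial (Fin n) ℂ}
    {ν : ι → ℂ} {ρ : κ → ℂ} {α : ι → (Fin n → ℝ) → ℂ} {β : κ → (Fin n → ℝ) → ℂ}
    (ha : ∀ i, (a i).IsHomogeneous (a i).totalDegree)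
    (hb : ∀ j, (b j).IsHomogeneous (b j).totalDegree)
    (hdeg : ∑ i, ν i * ((a i).totalDegree : ℂ) = ∑ j, ρ j * ((b j).totalDegree : ℂ))
    (hα : ∀ i, IsLogBranch (a i) (α i)) (hβ : ∀ j, IsLogBranch (b j) (β j))
    {x : Fin n → ℝ} (hx : x ∈ posOrthant n) {r : ℝ} (hr : 0 < r) :
    integrand a b ν ρ α β (r • x) = integrand a b ν ρ α β x := by
  simp only [integrand, branchPow_smul (ha _) (hα _) _ hx hr, branchPow_smul (hb _) (hβ _) _ hx hr,
    Finset.prod_mul_distrib, ← Complex.exp_sum, ← Finset.sum_mul, hdeg]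
  -- Numerator and denominator acquire the same factor because the degree condition is an equality
  -- of complex numbers, which matches the phases too.
  exact mul_div_mul_right _ _ (Complex.exp_ne_zero _)

/-- The residual is bounded. -/
theorem exists_norm_residual_le {a : ι → MvPolynomial (Fin n) ℂ} {b : κ → MvPolynomial (Fin n) ℂ}
    {ν : ι → ℂ} {ρ : κ → ℂ} {α : ι → (Fin n → ℝ) → ℂ} {β : κ → (Fin n → ℝ) → ℂ}
    (ha0 : ∀ i, a i ≠ 0) (hb0 : ∀ j, b j ≠ 0)
    (hν : ∀ i, 0 ≤ (ν i).re) (hρ : ∀ j, 0 ≤ (ρ j).re)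
    (hα : ∀ i, IsLogBranch (a i) (α i)) (hβ : ∀ j, IsLogBranch (b j) (β j))
    (hc : ∀ j, CompletelyNonvanishing (b j)) :
    ∃ K : ℝ, ∀ x ∈ posOrthant n, ‖residual a b ν ρ α β x‖ ≤ K := by
  choose K hK using fun i => exists_norm_branchPow_div_le (ha0 i) (hα i) (hν i)
  choose K' hK' using fun j => exists_norm_inv_branchPow_div_le (hb0 j) (hβ j) (hc j) (hρ j)
  refine ⟨(∏ i, K i) * ∏ j, K' j, fun x hx => ?_⟩
  rw [residual, div_eq_mul_inv, ← Finset.prod_inv_distrib, norm_mul, norm_prod, norm_prod]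
  have h1 : ∏ i, ‖branchPow (a i) (α i) (ν i) x / ((trop (a i) x ^ (ν i).re : ℝ) : ℂ)‖ ≤ ∏ i, K i :=
    Finset.prod_le_prod (fun _ _ => norm_nonneg _) fun i _ => hK i x hx
  refine mul_le_mul h1 (Finset.prod_le_prod (fun _ _ => norm_nonneg _) fun j _ => hK' j x hx)
    (Finset.prod_nonneg fun _ _ => norm_nonneg _) (le_trans (Finset.prod_nonneg fun _ _ => norm_nonneg _) h1)

theorem integrand_eq_residual_mul {a : ι → MvPolynomial (Fin n) ℂ}
    {b : κ → MvPolynomial (Fin n) ℂ} (ν : ι → ℂ) (ρ : κ → ℂ)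
    (α : ι → (Fin n → ℝ) → ℂ) (β : κ → (Fin n → ℝ) → ℂ)
    (ha0 : ∀ i, a i ≠ 0) (hb0 : ∀ j, b j ≠ 0) {x : Fin n → ℝ} (hx : x ∈ posOrthant n) :
    integrand a b ν ρ α β x = residual a b ν ρ α β x *
      (((∏ i, trop (a i) x ^ (ν i).re) / ∏ j, trop (b j) x ^ (ρ j).re : ℝ) : ℂ) := by
  have h1 : (∏ i, ((trop (a i) x ^ (ν i).re : ℝ) : ℂ)) ≠ 0 := Finset.prod_ne_zero_iff.2 fun i _ => by
    exact_mod_cast (Real.rpow_pos_of_pos (trop_pos (ha0 i) hx) _).ne'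
  have h2 : (∏ j, ((trop (b j) x ^ (ρ j).re : ℝ) : ℂ)) ≠ 0 := Finset.prod_ne_zero_iff.2 fun j _ => by
    exact_mod_cast (Real.rpow_pos_of_pos (trop_pos (hb0 j) hx) _).ne'
  rw [integrand, residual, Finset.prod_div_distrib, Finset.prod_div_distrib]
  push_cast
  field_simp

/-- The exponential of the support function of a weighted Newton polytope is the product of powers
of the tropical approximations. -/
theorem prod_trop_rpow_eq {a : ι → MvPolynomial (Fin n) ℂ} {ν : ι → ℂ} (ha0 : ∀ i, a i ≠ 0)
    (hν : ∀ i, 0 ≤ (ν i).re) {y v : Fin n → ℝ} (hv : v ∈ weightedNewtonPolytope a ν)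
    (hmax : ∀ v' ∈ weightedNewtonPolytope a ν, y ⬝ᵥ v' ≤ y ⬝ᵥ v) :
    ∏ i, trop (a i) (fun k => Real.exp (y k)) ^ (ν i).re = Real.exp (y ⬝ᵥ v) := by
  choose l hl ht using fun i => exists_trop_eq (ha0 i) fun k => Real.exp (y k)
  simp only [prod_exp_pow] at ht
  have hle : ∀ i, ∀ l' ∈ (a i).support, y ⬝ᵥ expVec l' ≤ y ⬝ᵥ expVec (l i) := fun i l' hl' => by
    rw [← Real.exp_le_exp, ← prod_exp_pow, ← ht]
    exact le_trop _ _ hl'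
  have h1 : ∏ i, trop (a i) (fun k => Real.exp (y k)) ^ (ν i).re
      = Real.exp (∑ i, (ν i).re * (y ⬝ᵥ expVec (l i))) := by
    rw [Real.exp_sum]
    refine Finset.prod_congr rfl fun i _ => ?_
    rw [ht, ← Real.exp_mul, mul_comm]
  rw [h1]
  congr 1
  -- The weighted sum of dominant exponents is a point of the polytope, hence bounded by the maximum
  -- at `v`. Conversely each Minkowski summand of `v` is bounded by its dominant exponent.
  refine le_antisymm ?_ ?_
  · have h2 : ∑ i, (ν i).re • expVec (l i) ∈ weightedNewtonPolytope a ν :=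
      Set.finsetSum_mem_finsetSum _ _ _ fun i _ =>
        Set.smul_mem_smul_set (expVec_mem_newtonPolytope (hl i))
    have h3 := hmax _ h2
    simpa [dotProduct_sum] using h3
  · obtain ⟨g, hg, rfl⟩ := (Set.mem_fintype_sum _ _).1 hv
    rw [dotProduct_sum]
    refine Finset.sum_le_sum fun i _ => ?_
    obtain ⟨g', hg', hgg⟩ := Set.mem_smul_set.1 (hg i)
    rw [← hgg, dotProduct_smul, smul_eq_mul]
    exact mul_le_mul_of_nonneg_left (dotProduct_le_of_mem_newtonPolytope (hle i) hg') (hν i)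

/-! ### Measurability -/

theorem measurable_evalReal (p : MvPolynomial (Fin n) ℂ) : Measurable (evalReal p) := by
  have : evalReal p = fun x => ∑ l : p.support, p.coeff l.1 * ((∏ k, x k ^ (l.1 k) : ℝ) : ℂ) :=
    funext fun x => evalReal_eq_sum p x
  rw [this]
  fun_prop

theorem measurable_trop (p : MvPolynomial (Fin n) ℂ) : Measurable (trop p) :=
  Measurable.iSup fun l => by fun_prop

theorem measurable_branchPow {p : MvPolynomial (Fin n) ℂ} {φ : (Fin n → ℝ) → ℂ}
    (hφ : IsLogBranch p φ) (s : ℂ) : Measurable (branchPow p φ s) := by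
  have h := hφ.measurable
  exact Measurable.ite (measurable_evalReal p (measurableSet_singleton 0)) measurable_const
    (by fun_prop)

theorem measurable_integrand {a : ι → MvPolynomial (Fin n) ℂ} {b : κ → MvPolynomial (Fin n) ℂ}
    (ν : ι → ℂ) (ρ : κ → ℂ) {α : ι → (Fin n → ℝ) → ℂ} {β : κ → (Fin n → ℝ) → ℂ}
    (hα : ∀ i, IsLogBranch (a i) (α i)) (hβ : ∀ j, IsLogBranch (b j) (β j)) :
    Measurable (integrand a b ν ρ α β) :=
  (Finset.measurable_fun_prod _ fun i _ => measurable_branchPow (hα i) _).div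
    (Finset.measurable_fun_prod _ fun j _ => measurable_branchPow (hβ j) _)

theorem measurable_residual {a : ι → MvPolynomial (Fin n) ℂ} {b : κ → MvPolynomial (Fin n) ℂ}
    (ν : ι → ℂ) (ρ : κ → ℂ) {α : ι → (Fin n → ℝ) → ℂ} {β : κ → (Fin n → ℝ) → ℂ}
    (hα : ∀ i, IsLogBranch (a i) (α i)) (hβ : ∀ j, IsLogBranch (b j) (β j)) :
    Measurable (residual a b ν ρ α β) :=
  (Finset.measurable_fun_prod _ fun i _ => (measurable_branchPow (hα i) _).div
      (Complex.measurable_ofReal.comp ((measurable_trop _).pow_const _))).div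
    (Finset.measurable_fun_prod _ fun j _ => (measurable_branchPow (hβ j) _).div
      (Complex.measurable_ofReal.comp ((measurable_trop _).pow_const _)))

end Families

/-! ### Weighted Newton polytopes -/

section Families

variable {n : ℕ} {ι : Type*} [Fintype ι]

theorem one_dotProduct_of_mem_newtonPolytope {p : MvPolynomial (Fin n) ℂ} {D : ℕ}
    (hp : p.IsHomogeneous D) {v : Fin n → ℝ} (hv : v ∈ newtonPolytope p) :
    (1 : Fin n → ℝ) ⬝ᵥ v = D := by
  have h : ∀ l ∈ p.support, (1 : Fin n → ℝ) ⬝ᵥ expVec l = D := fun l hl => by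
    have := hp (MvPolynomial.mem_support_iff.1 hl)
    rw [one_dotProduct, ← this, Finsupp.weight_apply, Finsupp.sum_fintype] <;> simp [expVec]
  refine le_antisymm (dotProduct_le_of_mem_newtonPolytope (fun l hl => (h l hl).le) hv) ?_
  have := dotProduct_le_of_mem_newtonPolytope (y := -1) (s := -D)
    (fun l hl => by rw [neg_dotProduct, h l hl]) hv
  rw [neg_dotProduct] at this
  linarith

/-- Homogeneity confines the polytope to a hyperplane orthogonal to `𝟙`. With (R1) this identifies
the directions of `ℬ` with all of `𝟙^⊥`. -/
theorem one_dotProduct_of_mem_weightedNewtonPolytope {a : ι → MvPolynomial (Fin n) ℂ} {ν : ι → ℂ}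
    (ha : ∀ i, (a i).IsHomogeneous (a i).totalDegree) {v : Fin n → ℝ}
    (hv : v ∈ weightedNewtonPolytope a ν) :
    (1 : Fin n → ℝ) ⬝ᵥ v = (∑ i, ν i * ((a i).totalDegree : ℂ)).re := by
  obtain ⟨g, hg, rfl⟩ := (Set.mem_fintype_sum _ _).1 hv
  rw [dotProduct_sum, Complex.re_sum]
  refine Finset.sum_congr rfl fun i _ => ?_
  obtain ⟨g', hg', hgg⟩ := Set.mem_smul_set.1 (hg i)
  rw [← hgg, dotProduct_smul, one_dotProduct_of_mem_newtonPolytope (ha i) hg']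
  simp

theorem exists_forall_dotProduct_le {a : ι → MvPolynomial (Fin n) ℂ} {ν : ι → ℂ}
    (ha0 : ∀ i, a i ≠ 0) (hν : ∀ i, 0 ≤ (ν i).re) (y : Fin n → ℝ) :
    ∃ v ∈ weightedNewtonPolytope a ν, ∀ v' ∈ weightedNewtonPolytope a ν, y ⬝ᵥ v' ≤ y ⬝ᵥ v := by
  choose l hl hmax using fun i => Finset.exists_max_image (a i).support (fun l => y ⬝ᵥ expVec l)
    (MvPolynomial.support_nonempty.2 (ha0 i))
  refine ⟨∑ i, (ν i).re • expVec (l i), Set.finsetSum_mem_finsetSum _ _ _ fun i _ =>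
    Set.smul_mem_smul_set (expVec_mem_newtonPolytope (hl i)), fun v' hv' => ?_⟩
  obtain ⟨g, hg, rfl⟩ := (Set.mem_fintype_sum _ _).1 hv'
  rw [dotProduct_sum, dotProduct_sum]
  refine Finset.sum_le_sum fun i _ => ?_
  obtain ⟨g', hg', hgg⟩ := Set.mem_smul_set.1 (hg i)
  rw [← hgg, dotProduct_smul, dotProduct_smul]
  exact mul_le_mul_of_nonneg_left (dotProduct_le_of_mem_newtonPolytope (hmax i) hg') (hν i)

end Families

/-- A linear functional that is not constant on `B` is strictly larger at its maximum over `B` than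
at a point of the relative interior. -/
theorem dotProduct_sub_pos {d : ℕ} {B : Set (Fin (d + 1) → ℝ)} {D : ℝ}
    (hB : ∀ v ∈ B, (1 : Fin (d + 1) → ℝ) ⬝ᵥ v = D)
    (hdim : Module.finrank ℝ (vectorSpan ℝ B) = d) {y wA wB : Fin (d + 1) → ℝ}
    (hy : toTrop y ≠ 0) (hwA : wA ∈ intrinsicInterior ℝ B) (hmax : ∀ v ∈ B, y ⬝ᵥ v ≤ y ⬝ᵥ wB) :
    0 < y ⬝ᵥ (wB - wA) := by
  let e : (Fin (d + 1) → ℝ) →ₗ[ℝ] ℝ :=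
    { toFun := fun v => (1 : Fin (d + 1) → ℝ) ⬝ᵥ v
      map_add' := fun _ _ => dotProduct_add _ _ _
      map_smul' := fun c v => by rw [dotProduct_smul]; rfl }
  have he : e ≠ 0 := fun h => by
    have := LinearMap.congr_fun h (Pi.single 0 1)
    simp [e] at this
  have hH : Module.finrank ℝ (LinearMap.ker e) = d := by
    have := Module.Dual.finrank_ker_add_one_of_ne_zero he
    simpa using this
  have hspan : vectorSpan ℝ B = LinearMap.ker e := by
    refine Submodule.eq_of_le_of_finrank_eq ?_ (hdim.trans hH.symm)
    refine Submodule.span_le.2 ?_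
    rintro _ ⟨v, hv, v', hv', rfl⟩
    change (1 : Fin (d + 1) → ℝ) ⬝ᵥ (v - v') = 0
    rw [dotProduct_sub, hB v hv, hB v' hv', sub_self]
  -- Subtracting the mean `m` of the coordinates projects `y` orthogonally onto `𝟙^⊥`. Hence `⟨y, z⟩
  -- = ⟨z, z⟩`, which is positive since `y` is not a multiple of `𝟙`.
  set m : ℝ := (∑ k, y k) / (d + 1) with hm
  set z : Fin (d + 1) → ℝ := y - m • 1 with hz
  have h1z : (1 : Fin (d + 1) → ℝ) ⬝ᵥ z = 0 := by
    rw [hz, dotProduct_sub, dotProduct_smul, one_dotProduct, one_dotProduct]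
    simp only [Pi.one_apply, Finset.sum_const, Finset.card_univ, Fintype.card_fin, smul_eq_mul, hm]
    field_simp
    simp
  have hz0 : z ≠ 0 := fun h => hy <| by
    rw [toTrop, Submodule.mkQ_apply, Submodule.Quotient.mk_eq_zero, Submodule.mem_span_singleton]
    exact ⟨m, (sub_eq_zero.1 h).symm⟩
  have hyz : 0 < y ⬝ᵥ z := by
    have : y ⬝ᵥ z = z ⬝ᵥ z := by
      conv_lhs => rw [show y = z + m • 1 by rw [hz]; abel]
      rw [add_dotProduct, smul_dotProduct, h1z, smul_zero, add_zero]
    rw [this]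
    exact lt_of_le_of_ne (Finset.sum_nonneg fun k _ => mul_self_nonneg _)
      (Ne.symm (dotProduct_self_eq_zero.not.2 hz0))
  obtain ⟨q, hq, rfl⟩ := mem_intrinsicInterior.1 hwA
  have hzdir : z ∈ (affineSpan ℝ B).direction := by
    rw [direction_affineSpan, hspan]
    exact h1z
  -- A short step from the relative interior point in direction `z` stays in `B` and strictly
  -- increases `⟨y, ·⟩`.
  let γ : ℝ → affineSpan ℝ B := fun t =>
    ⟨(t • z) +ᵥ (q : Fin (d + 1) → ℝ),
      AffineSubspace.vadd_mem_of_mem_direction (Submodule.smul_mem _ t hzdir) q.2⟩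
  have hγ : Continuous γ := by
    refine Continuous.subtype_mk (f := fun t : ℝ => (t • z) +ᵥ (q : Fin (d + 1) → ℝ)) ?_ _
    simp only [vadd_eq_add]
    fun_prop
  have hγ0 : γ 0 = q := Subtype.ext (by simp [γ])
  have hev : ∀ᶠ t in 𝓝 (0 : ℝ), γ t ∈ interior ((↑) ⁻¹' B : Set (affineSpan ℝ B)) :=
    hγ.continuousAt.eventually (by rw [hγ0]; exact isOpen_interior.mem_nhds hq)
  obtain ⟨ε, hε, hball⟩ := Metric.eventually_nhds_iff.1 hev
  have hmem : (ε / 2) • z + (q : Fin (d + 1) → ℝ) ∈ B := by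
    have := interior_subset (hball (y := ε / 2) (by
      rw [Real.dist_eq, sub_zero, abs_of_pos (half_pos hε)]; linarith))
    simpa [γ] using this
  have := hmax _ hmem
  rw [dotProduct_add, dotProduct_smul, smul_eq_mul] at this
  rw [dotProduct_sub]
  have := mul_pos (half_pos hε) hyz
  linarith

/-! ### The affine chart of tropical projective space -/

/-- The coordinates of a class in the chart where the last coordinate is zero. -/
def dehomogenize {d : ℕ} (y : Fin (d + 1) → ℝ) : Fin d → ℝ :=
  fun k => y k.castSucc - y (Fin.last d)

theorem snoc_dehomogenize {d : ℕ} (y : Fin (d + 1) → ℝ) :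
    y = Fin.snoc (α := fun _ => ℝ) (dehomogenize y) 0 + y (Fin.last d) • (1 : Fin (d + 1) → ℝ) := by
  ext k
  refine Fin.lastCases ?_ (fun k => ?_) k <;> simp [dehomogenize]

/-- The chart of tropical projective space in which the last coordinate is zero. -/
def tropChart (d : ℕ) : (Fin d → ℝ) →ₗ[ℝ] TropSpace (d + 1) :=
  (Submodule.span ℝ {(1 : Fin (d + 1) → ℝ)}).mkQ ∘ₗ
    { toFun := fun y => Fin.snoc (α := fun _ => ℝ) y 0
      map_add' := fun y z => by
        ext k
        refine Fin.lastCases ?_ (fun k => ?_) k <;> simp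
      map_smul' := fun c y => by
        ext k
        refine Fin.lastCases ?_ (fun k => ?_) k <;> simp }

theorem tropChart_apply {d : ℕ} (y : Fin d → ℝ) :
    tropChart d y = toTrop (Fin.snoc (α := fun _ => ℝ) y 0) := rfl

theorem tropChart_dehomogenize {d : ℕ} (y : Fin (d + 1) → ℝ) :
    tropChart d (dehomogenize y) = toTrop y := by
  rw [tropChart_apply]
  conv_rhs => rw [snoc_dehomogenize y]
  rw [toTrop, toTrop, map_add, left_eq_add, Submodule.mkQ_apply, Submodule.Quotient.mk_eq_zero]
  exact Submodule.smul_mem _ _ (Submodule.mem_span_singleton_self _)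

theorem tropChart_injective (d : ℕ) : Function.Injective (tropChart d) := by
  refine (injective_iff_map_eq_zero _).2 fun y hy => ?_
  rw [tropChart_apply, toTrop, Submodule.mkQ_apply, Submodule.Quotient.mk_eq_zero,
    Submodule.mem_span_singleton] at hy
  obtain ⟨c, hc⟩ := hy
  have h0 : c = 0 := by simpa using congrFun hc (Fin.last d)
  ext k
  have := congrFun hc k.castSucc
  simp only [h0, zero_smul, Fin.snoc_castSucc] at this
  exact this.symm

theorem tropChart_surjective (d : ℕ) : Function.Surjective (tropChart d) := by
  intro q
  obtain ⟨y, rfl⟩ := Submodule.mkQ_surjective _ q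
  exact ⟨dehomogenize y, tropChart_dehomogenize y⟩

theorem finrank_tropSpace (d : ℕ) : Module.finrank ℝ (TropSpace (d + 1)) = d := by
  rw [← (LinearEquiv.ofBijective (tropChart d)
    ⟨tropChart_injective d, tropChart_surjective d⟩).finrank_eq, Module.finrank_fin_fun]

/-! ### Sectors -/

theorem volume_preimage_tropChart_eq_zero {d : ℕ} {S : Submodule ℝ (TropSpace (d + 1))}
    (hS : S ≠ ⊤) {C : Set (TropSpace (d + 1))} (hC : C ⊆ S) :
    volume (tropChart d ⁻¹' C) = 0 := by
  refine measure_mono_null (Set.preimage_mono hC)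
    (Measure.addHaar_submodule volume (S.comap (tropChart d)) fun h => hS ?_)
  rw [eq_top_iff]
  rintro q -
  obtain ⟨y, rfl⟩ := tropChart_surjective d q
  have : y ∈ S.comap (tropChart d) := by rw [h]; trivial
  exact this

theorem volume_preimage_of_coneDim_lt {d : ℕ} {C : Set (TropSpace (d + 1))} (hC : coneDim C < d) :
    volume (tropChart d ⁻¹' C) = 0 := by
  refine volume_preimage_tropChart_eq_zero (S := Submodule.span ℝ C) (fun h => ?_)
    Submodule.subset_span
  rw [coneDim, h, finrank_top, finrank_tropSpace] at hC
  exact lt_irrefl _ hC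

theorem coneDim_le {d : ℕ} (C : Set (TropSpace (d + 1))) : coneDim C ≤ d :=
  (Submodule.finrank_le _).trans_eq (finrank_tropSpace d)

/-- Normal fans of polytopes are complete: `y` lies in the normal cone of the face on which it is
itself maximal. -/
theorem IsSimplicialRefinement.exists_mem {n : ℕ} {A B : Set (Fin n → ℝ)}
    {𝓕 : Finset (Set (TropSpace n))} (h : IsSimplicialRefinement A B 𝓕)
    (hA : ∀ y : Fin n → ℝ, ∃ v ∈ A, ∀ v' ∈ A, y ⬝ᵥ v' ≤ y ⬝ᵥ v)
    (hB : ∀ y : Fin n → ℝ, ∃ v ∈ B, ∀ v' ∈ B, y ⬝ᵥ v' ≤ y ⬝ᵥ v) (q : TropSpace n) :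
    ∃ C ∈ 𝓕, q ∈ C := by
  obtain ⟨y, rfl⟩ := Submodule.mkQ_surjective _ q
  have key : ∀ P : Set (Fin n → ℝ), (∃ v ∈ P, ∀ v' ∈ P, y ⬝ᵥ v' ≤ y ⬝ᵥ v) →
      ∃ C ∈ normalFan P, y ∈ C := fun P ⟨v, hv, hm⟩ =>
    ⟨_, ⟨{v | v ∈ P ∧ ∀ w ∈ P, y ⬝ᵥ w ≤ y ⬝ᵥ v}, ⟨y, rfl⟩, ⟨v, hv, hm⟩, rfl⟩,
      fun v hv w hw => hv.2 w hw⟩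
  obtain ⟨CA, hCA, hyA⟩ := key A (hA y)
  obtain ⟨CB, hCB, hyB⟩ := key B (hB y)
  obtain ⟨𝓢, h𝓢, he⟩ := h.refines (toTrop '' (CA ∩ CB)) ⟨_, ⟨CA, hCA, CB, hCB, rfl⟩, rfl⟩
  have hmem : toTrop y ∈ ⋃₀ 𝓢 := he ▸ ⟨y, ⟨hyA, hyB⟩, rfl⟩
  obtain ⟨C, hC, hy⟩ := hmem
  exact ⟨C, h𝓢 hC, hy⟩

/-- Finitely many cones of dimension below `d` are null sets and cannot cover the space. -/
theorem coneDim_of_mem_maximalCones {d : ℕ} {𝓕 : Finset (Set (TropSpace (d + 1)))}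
    (hcov : ∀ q, ∃ C ∈ 𝓕, q ∈ C) {C : Set (TropSpace (d + 1))} (hC : C ∈ maximalCones 𝓕) :
    coneDim C = d := by
  classical
  rw [maximalCones, Finset.mem_filter] at hC
  refine (coneDim_le C).eq_of_not_lt fun hlt => ?_
  have h0 : volume (⋃ C' ∈ 𝓕, tropChart d ⁻¹' C') = 0 :=
    (measure_biUnion_null_iff 𝓕.countable_toSet).2 fun C' hC' =>
      volume_preimage_of_coneDim_lt ((hC.2 C' hC').trans_lt hlt)
  have h1 : (⋃ C' ∈ 𝓕, tropChart d ⁻¹' C') = Set.univ := by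
    refine Set.eq_univ_of_forall fun y => ?_
    obtain ⟨C', hC', hy⟩ := hcov (tropChart d y)
    exact Set.mem_biUnion hC' hy
  rw [h1] at h0
  exact (NeZero.ne (volume : Measure (Fin d → ℝ))) (Measure.measure_univ_eq_zero.1 h0)

theorem iUnion_maximalCones_ae_eq_univ {d : ℕ} {𝓕 : Finset (Set (TropSpace (d + 1)))}
    (hcov : ∀ q, ∃ C ∈ 𝓕, q ∈ C) :
    (⋃ C : maximalCones 𝓕, tropChart d ⁻¹' (C : Set (TropSpace (d + 1)))) =ᵐ[volume] Set.univ := by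
  classical
  rw [ae_eq_univ]
  refine measure_mono_null (t := ⋃ C ∈ {C ∈ 𝓕 | coneDim C < d}, tropChart d ⁻¹' C) ?_
    ((measure_biUnion_null_iff (Finset.countable_toSet _)).2 fun C hC =>
      volume_preimage_of_coneDim_lt (Finset.mem_filter.1 hC).2)
  intro y hy
  obtain ⟨C, hC, hyC⟩ := hcov (tropChart d y)
  refine Set.mem_biUnion (Finset.mem_filter.2 ⟨hC, ?_⟩) hyC
  by_contra hlt
  refine hy (Set.mem_iUnion.2 ⟨⟨C, ?_⟩, hyC⟩)
  rw [maximalCones, Finset.mem_filter]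
  exact ⟨hC, fun C' _ => (coneDim_le C').trans (not_lt.1 hlt)⟩

theorem IsFan.aedisjoint {d : ℕ} {𝓕 : Set (Set (TropSpace (d + 1)))} (h : IsFan 𝓕)
    {C C' : Set (TropSpace (d + 1))} (hC : C ∈ 𝓕) (hC' : C' ∈ 𝓕) (hne : C ≠ C') :
    AEDisjoint volume (tropChart d ⁻¹' C) (tropChart d ⁻¹' C') := by
  have key : ∀ {C : Set (TropSpace (d + 1))} {F}, IsConeFace C F → F ≠ C →
      volume (tropChart d ⁻¹' F) = 0 := by
    rintro C F ⟨f, -, rfl⟩ hF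
    refine volume_preimage_tropChart_eq_zero (S := LinearMap.ker f) (fun hf => hF ?_) fun y hy => hy.2
    ext y
    have : f y = 0 := by
      have : y ∈ LinearMap.ker f := by rw [hf]; trivial
      exact this
    simp [this]
  rw [AEDisjoint, ← Set.preimage_inter]
  obtain ⟨h1, h2⟩ := h.inter_face C hC C' hC'
  -- The intersection is a proper face of at least one of the two distinct cones, and a proper face
  -- lies in a hyperplane.
  by_cases he : C ∩ C' = C
  · exact key h2 fun he' => hne (he.symm.trans he')
  · exact key h1 he

theorem mem_of_mem_maximalCones {n : ℕ} {𝓕 : Finset (Set (TropSpace n))} {C : Set (TropSpace n)}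
    (hC : C ∈ maximalCones 𝓕) : C ∈ 𝓕 := by
  classical
  rw [maximalCones] at hC
  exact Finset.mem_of_mem_filter C hC

/-- Generators of a cone of full dimension are linearly independent. -/
theorem linearIndependent_of_coneDim_eq {d : ℕ} {u : Fin d → TropSpace (d + 1)}
    (h : coneDim (coneSpan u) = d) : LinearIndependent ℝ u := by
  refine linearIndependent_of_top_le_span_of_card_eq_finrank ?_ ?_
  · have h1 : Submodule.span ℝ (coneSpan u) = ⊤ :=
      Submodule.eq_top_of_finrank_eq (by rw [finrank_tropSpace]; exact h)
    rw [← h1]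
    refine Submodule.span_le.2 ?_
    rintro _ ⟨c, -, rfl⟩
    exact Submodule.sum_mem _ fun k _ => Submodule.smul_mem _ _ (Submodule.subset_span ⟨k, rfl⟩)
  · rw [Fintype.card_fin, finrank_tropSpace]

theorem linearIndependent_dehomogenize {d m : ℕ} {u : Fin m → Fin (d + 1) → ℝ}
    (h : LinearIndependent ℝ fun k => toTrop (u k)) :
    LinearIndependent ℝ fun k => dehomogenize (u k) := by
  refine LinearIndependent.of_comp (tropChart d) ?_
  simpa [Function.comp_def, tropChart_dehomogenize] using h

theorem preimage_tropChart_coneSpan {d m : ℕ} (u : Fin m → Fin (d + 1) → ℝ) :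
    tropChart d ⁻¹' coneSpan (fun k => toTrop (u k)) = coneSpan fun k => dehomogenize (u k) := by
  ext y
  constructor
  · rintro ⟨c, hc, h⟩
    refine ⟨c, hc, tropChart_injective d ?_⟩
    rw [h, map_sum]
    simp [tropChart_dehomogenize]
  · rintro ⟨c, hc, rfl⟩
    refine ⟨c, hc, ?_⟩
    rw [map_sum]
    simp [tropChart_dehomogenize]

/-- Subtracting the last column from the others turns the row `𝟙` into `(0, …, 0, 1)`; the
determinant is then expanded along that row. -/
theorem det_snoc_one {d : ℕ} (u : Fin d → Fin (d + 1) → ℝ) :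
    (Matrix.of (Fin.snoc (α := fun _ => Fin (d + 1) → ℝ) u 1)).det =
      (Matrix.of fun k => dehomogenize (u k)).det := by
  let M : Matrix (Fin (d + 1)) (Fin (d + 1)) ℝ := Matrix.of fun i j =>
    Fin.lastCases (motive := fun _ => ℝ) (if j = Fin.last d then 1 else 0)
      (fun i => Fin.lastCases (motive := fun _ => ℝ) (u i (Fin.last d))
        (fun j => dehomogenize (u i) j) j) i
  have h1 : (Matrix.of (Fin.snoc (α := fun _ => Fin (d + 1) → ℝ) u 1)).det = M.det := by
    rw [← Matrix.det_transpose, ← Matrix.det_transpose M]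
    refine Matrix.det_eq_of_forall_row_eq_smul_add_const
      (fun j => if j = Fin.last d then 0 else 1) (Fin.last d) (by simp) fun j i => ?_
    refine Fin.lastCases ?_ (fun i => ?_) i <;> refine Fin.lastCases ?_ (fun j => ?_) j <;>
      simp [M, dehomogenize]
  rw [h1, Matrix.det_succ_row M (Fin.last d), Finset.sum_eq_single (Fin.last d)]
  · simp only [M, Matrix.of_apply, Fin.lastCases_last, if_true, mul_one]
    rw [Even.neg_one_pow ⟨_, rfl⟩, one_mul]
    congr 1
    ext i j
    simp
  · intro j _ hj
    simp [M, hj]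
  · simp

/-! ### Changes of variables -/

theorem measurableSet_posOrthant (d : ℕ) : MeasurableSet (posOrthant d) := by
  have : posOrthant d = Set.univ.pi fun _ => Set.Ioi (0 : ℝ) := by
    ext x; simp [posOrthant]
  rw [this]
  exact MeasurableSet.univ_pi fun _ => measurableSet_Ioi

/-- This shape covers both changes of variables: coordinatewise logarithms (`v = 1`) and the map
from cube to cone. -/
theorem hasFDerivAt_sum_mul_comp {d : ℕ} {f : Fin d → ℝ → ℝ} {f' x : Fin d → ℝ}
    (hf : ∀ i, HasDerivAt (f i) (f' i) (x i)) (v : Matrix (Fin d) (Fin d) ℝ) :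
    HasFDerivAt (fun x k => ∑ i, f i (x i) * v i k)
      (LinearMap.toContinuousLinearMap (Matrix.toLin' (v.transpose * Matrix.diagonal f'))) x := by
  rw [hasFDerivAt_pi']
  intro k
  have h : ∀ i, HasFDerivAt (fun x : Fin d → ℝ => f i (x i) * v i k)
      ((f' i * v i k) • ContinuousLinearMap.proj (R := ℝ) (φ := fun _ : Fin d => ℝ) i) x := fun i => by
    have h1 := ((hf i).mul_const (v i k)).comp_hasFDerivAt x
      (ContinuousLinearMap.proj (R := ℝ) (φ := fun _ : Fin d => ℝ) i).hasFDerivAt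
    exact h1
  have h2 := HasFDerivAt.fun_sum (u := Finset.univ) fun i _ => h i
  convert! h2 using 1
  ext z
  simp [Matrix.mulVec, dotProduct, Matrix.mul_apply, Matrix.diagonal_apply]
  refine Finset.sum_congr rfl fun i _ => ?_
  ring

theorem det_toContinuousLinearMap_mul_diagonal {d : ℕ} (v : Matrix (Fin d) (Fin d) ℝ)
    (f' : Fin d → ℝ) :
    (LinearMap.toContinuousLinearMap (Matrix.toLin' (v.transpose * Matrix.diagonal f'))).det =
      v.det * ∏ i, f' i := by
  change LinearMap.det (Matrix.toLin' (v.transpose * Matrix.diagonal f')) = _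
  rw [LinearMap.det_toLin', Matrix.det_mul, Matrix.det_transpose, Matrix.det_diagonal]

/-- In logarithmic coordinates the canonical form is the Lebesgue measure. -/
theorem map_log_canonicalMeasure (d : ℕ) :
    (canonicalMeasure d).map (fun x k => Real.log (x k)) = volume := by
  have hmap := map_withDensity_abs_det_fderiv_eq_addHaar (s := posOrthant d)
    (f := fun x k => Real.log (x k)) volume
    (f' := fun x => LinearMap.toContinuousLinearMap (Matrix.toLin'
      ((1 : Matrix (Fin d) (Fin d) ℝ).transpose * Matrix.diagonal fun i => (x i)⁻¹)))
    (measurableSet_posOrthant d).nullMeasurableSet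
    (fun x hx => by
      have := hasFDerivAt_sum_mul_comp (fun i => Real.hasDerivAt_log (hx i).ne')
        (1 : Matrix (Fin d) (Fin d) ℝ)
      simp only [Matrix.one_apply, mul_ite, mul_one, mul_zero, Finset.sum_ite_eq',
        Finset.mem_univ, if_true] at this
      exact this.hasFDerivWithinAt)
    (fun x hx y hy h => funext fun k => Real.log_injOn_pos (hx k) (hy k) (congrFun h k))
  have himg : (fun (x : Fin d → ℝ) k => Real.log (x k)) '' posOrthant d = Set.univ :=
    Set.eq_univ_of_forall fun y => ⟨fun k => Real.exp (y k), fun k => Real.exp_pos _,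
      funext fun k => Real.log_exp _⟩
  rw [himg, Measure.restrict_univ] at hmap
  rw [← hmap, canonicalMeasure]
  congr 1
  refine withDensity_congr_ae ?_
  filter_upwards [ae_restrict_mem (measurableSet_posOrthant d)] with x hx
  rw [det_toContinuousLinearMap_mul_diagonal, Matrix.det_one, one_mul,
    abs_of_pos (Finset.prod_pos fun k _ => inv_pos.2 (hx k))]

theorem ae_canonicalMeasure_mem (d : ℕ) : ∀ᵐ x ∂(canonicalMeasure d), x ∈ posOrthant d :=
  (withDensity_absolutelyContinuous _ _).ae_le (ae_restrict_mem (measurableSet_posOrthant d))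

theorem measurable_log_pi (d : ℕ) : Measurable fun (x : Fin d → ℝ) k => Real.log (x k) := by
  fun_prop

/-- The half-open unit cube. -/
def unitCube (d : ℕ) : Set (Fin d → ℝ) := Set.univ.pi fun _ => Set.Ioc 0 1

theorem mem_unitCube {d : ℕ} {ξ : Fin d → ℝ} : ξ ∈ unitCube d ↔ ∀ i, 0 < ξ i ∧ ξ i ≤ 1 := by
  simp [unitCube]

theorem measurableSet_unitCube (d : ℕ) : MeasurableSet (unitCube d) :=
  MeasurableSet.univ_pi fun _ => measurableSet_Ioc

theorem unitCube_ae_eq (d : ℕ) : unitCube d =ᵐ[volume] Set.Icc (0 : Fin d → ℝ) 1 :=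
  Measure.univ_pi_Ioc_ae_eq_Icc

/-- The parametrization of a simplicial cone by the unit cube. -/
noncomputable def cubeToCone {d : ℕ} (v : Fin d → Fin d → ℝ) (c : Fin d → ℝ) (ξ : Fin d → ℝ) : Fin d → ℝ :=
  fun k => ∑ i, -Real.log (ξ i) / c i * v i k

theorem cubeToCone_eq_sum {d : ℕ} (v : Fin d → Fin d → ℝ) (c ξ : Fin d → ℝ) :
    cubeToCone v c ξ = ∑ i, (-Real.log (ξ i) / c i) • v i := by
  ext k
  simp [cubeToCone, Finset.sum_apply]

/-- As `ξᵢ` runs over `(0, 1]`, `-log ξᵢ` runs over `[0, ∞)`. The half-open cube thus gives exactly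
the closed cone and avoids the singularity at `0`. -/
theorem image_cubeToCone {d : ℕ} (v : Fin d → Fin d → ℝ) {c : Fin d → ℝ} (hc : ∀ i, 0 < c i) :
    cubeToCone v c '' unitCube d = coneSpan v := by
  ext y
  constructor
  · rintro ⟨ξ, hξ, rfl⟩
    rw [mem_unitCube] at hξ
    exact ⟨fun i => -Real.log (ξ i) / c i, fun i => div_nonneg
      (neg_nonneg.2 (Real.log_nonpos (hξ i).1.le (hξ i).2)) (hc i).le, cubeToCone_eq_sum _ _ _⟩
  · rintro ⟨t, ht, rfl⟩
    refine ⟨fun i => Real.exp (-(t i * c i)), mem_unitCube.2 fun i => ⟨Real.exp_pos _,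
      Real.exp_le_one_iff.2 (neg_nonpos.2 (mul_nonneg (ht i) (hc i).le))⟩, ?_⟩
    rw [cubeToCone_eq_sum]
    refine Finset.sum_congr rfl fun i _ => ?_
    rw [Real.log_exp, neg_neg, mul_div_cancel_right₀ _ (hc i).ne']

theorem injOn_cubeToCone {d : ℕ} {v : Fin d → Fin d → ℝ} (hv : LinearIndependent ℝ v)
    {c : Fin d → ℝ} (hc : ∀ i, 0 < c i) : Set.InjOn (cubeToCone v c) (unitCube d) := by
  intro ξ hξ η hη h
  rw [mem_unitCube] at hξ hη
  rw [cubeToCone_eq_sum, cubeToCone_eq_sum] at h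
  ext i
  have := Fintype.linearIndependent_iffₛ.1 hv _ _ h i
  have h1 : Real.log (ξ i) = Real.log (η i) := by
    have h2 := (hc i).ne'
    field_simp at this
    linarith
  exact Real.log_injOn_pos (hξ i).1 (hη i).1 h1

theorem hasFDerivAt_cubeToCone {d : ℕ} (v : Fin d → Fin d → ℝ) (c : Fin d → ℝ) {ξ : Fin d → ℝ}
    (hξ : ξ ∈ unitCube d) :
    HasFDerivAt (cubeToCone v c) (LinearMap.toContinuousLinearMap (Matrix.toLin'
      ((Matrix.of v).transpose * Matrix.diagonal fun i => -(ξ i)⁻¹ / c i))) ξ :=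
  hasFDerivAt_sum_mul_comp (f := fun i t => -Real.log t / c i)
    (fun i => ((Real.hasDerivAt_log (mem_unitCube.1 hξ i).1.ne').neg.div_const (c i))) (Matrix.of v)

theorem abs_det_fderiv_cubeToCone {d : ℕ} (v : Fin d → Fin d → ℝ) {c : Fin d → ℝ}
    (hc : ∀ i, 0 < c i) {ξ : Fin d → ℝ} (hξ : ξ ∈ unitCube d) :
    |(LinearMap.toContinuousLinearMap (Matrix.toLin'
      ((Matrix.of v).transpose * Matrix.diagonal fun i => -(ξ i)⁻¹ / c i))).det| =
      |(Matrix.of v).det| / (∏ i, c i) / ∏ i, ξ i := by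
  rw [det_toContinuousLinearMap_mul_diagonal, abs_mul, Finset.abs_prod, div_div,
    ← Finset.prod_mul_distrib, div_eq_mul_inv, ← Finset.prod_inv_distrib]
  congr 1
  refine Finset.prod_congr rfl fun i _ => ?_
  have := (mem_unitCube.1 hξ i).1
  rw [abs_div, abs_neg, abs_inv, abs_of_pos this, abs_of_pos (hc i), mul_inv, div_eq_mul_inv,
    mul_comm]

/-- Change of variables from a simplicial cone to the unit cube. -/
theorem integrableOn_and_integral_coneSpan {d : ℕ} {v : Fin d → Fin d → ℝ}
    (hv : LinearIndependent ℝ v) {c : Fin d → ℝ} (hc : ∀ i, 0 < c i) {g f : (Fin d → ℝ) → ℂ}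
    (hgf : ∀ ξ ∈ unitCube d, g (cubeToCone v c ξ) = f ξ * ((∏ i, ξ i : ℝ) : ℂ))
    (hf : IntegrableOn f (unitCube d)) :
    IntegrableOn g (coneSpan v) ∧
      ∫ y in coneSpan v, g y = ((|(Matrix.of v).det| / ∏ i, c i : ℝ) : ℂ) * ∫ ξ in unitCube d, f ξ := by
  -- The `1 / ∏ ξᵢ` in the Jacobian cancels the factor `∏ ξᵢ` from `hgf`.
  have key : ∀ ξ ∈ unitCube d, |(LinearMap.toContinuousLinearMap (Matrix.toLin'
      ((Matrix.of v).transpose * Matrix.diagonal fun i => -(ξ i)⁻¹ / c i))).det| •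
      g (cubeToCone v c ξ) = ((|(Matrix.of v).det| / ∏ i, c i : ℝ) : ℂ) * f ξ := by
    intro ξ hξ
    have h1 : ((∏ i, ξ i : ℝ) : ℂ) ≠ 0 := by
      exact_mod_cast (Finset.prod_pos fun i _ => (mem_unitCube.1 hξ i).1).ne'
    rw [abs_det_fderiv_cubeToCone v hc hξ, hgf ξ hξ, Complex.real_smul, Complex.ofReal_div]
    field_simp
  have hd := fun ξ (hξ : ξ ∈ unitCube d) =>
    (hasFDerivAt_cubeToCone v c hξ).hasFDerivWithinAt (s := unitCube d)
  rw [← image_cubeToCone v hc]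
  constructor
  · rw [integrableOn_image_iff_integrableOn_abs_det_fderiv_smul volume (measurableSet_unitCube d)
      hd (injOn_cubeToCone hv hc), integrableOn_congr_fun key (measurableSet_unitCube d)]
    exact hf.const_mul _
  · rw [integral_image_eq_integral_abs_det_fderiv_smul volume (measurableSet_unitCube d)
      hd (injOn_cubeToCone hv hc), setIntegral_congr_fun (measurableSet_unitCube d) key,
      integral_const_mul]

/-! ### Variance of complex random variables -/

section Variance

variable {Ω : Type*} [MeasurableSpace Ω] {P : Measure Ω}

/-- Splitting into real and imaginary parts reduces additivity under independence to the real case.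
-/
theorem complexVariance_eq_add [IsFiniteMeasure P] {X : Ω → ℂ} (hX : MemLp X 2 P) :
    complexVariance X P = Var[fun ω => (X ω).re; P] + Var[fun ω => (X ω).im; P] := by
  have hi : Integrable X P := hX.integrable (by norm_num)
  have hre : MemLp (fun ω => (X ω).re) 2 P := hX.re
  have him : MemLp (fun ω => (X ω).im) 2 P := hX.im
  have e1 : ∫ ω, (X ω).re ∂P = (∫ ω, X ω ∂P).re := Complex.reCLM.integral_comp_comm hi
  have e2 : ∫ ω, (X ω).im ∂P = (∫ ω, X ω ∂P).im := Complex.imCLM.integral_comp_comm hi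
  have i1 : Integrable (fun ω => ((X ω).re - (∫ ω, X ω ∂P).re) ^ 2) P :=
    (hre.sub (memLp_const _)).integrable_sq
  have i2 : Integrable (fun ω => ((X ω).im - (∫ ω, X ω ∂P).im) ^ 2) P :=
    (him.sub (memLp_const _)).integrable_sq
  rw [variance_eq_integral hre.aemeasurable, variance_eq_integral him.aemeasurable, e1, e2,
    ← integral_add i1 i2, complexVariance]
  refine integral_congr_ae (Eventually.of_forall fun ω => ?_)
  simp only [Complex.sq_norm, Complex.normSq_apply, Complex.sub_re, Complex.sub_im]
  ring

theorem complexVariance_sum [IsFiniteMeasure P] {σ : Type*} [Fintype σ] {X : σ → Ω → ℂ}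
    (hX : ∀ s, MemLp (X s) 2 P) (hind : iIndepFun X P) :
    complexVariance (fun ω => ∑ s, X s ω) P = ∑ s, complexVariance (X s) P := by
  have hre := fun s => (hX s).re
  have him := fun s => (hX s).im
  have h1 : Var[∑ s, fun ω => (X s ω).re; P] = ∑ s, Var[fun ω => (X s ω).re; P] :=
    IndepFun.variance_sum (fun s _ => hre s) fun s _ t _ hst =>
      (hind.indepFun hst).comp Complex.measurable_re Complex.measurable_re
  have h2 : Var[∑ s, fun ω => (X s ω).im; P] = ∑ s, Var[fun ω => (X s ω).im; P] :=
    IndepFun.variance_sum (fun s _ => him s) fun s _ t _ hst =>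
      (hind.indepFun hst).comp Complex.measurable_im Complex.measurable_im
  rw [complexVariance_eq_add (memLp_finsetSum _ fun s _ => hX s)]
  simp only [complexVariance_eq_add (hX _), Complex.re_sum, Complex.im_sum]
  rw [Finset.sum_add_distrib, ← h1, ← h2]
  congr 2 <;> ext ω <;> simp

theorem complexVariance_const_mul (c : ℂ) (X : Ω → ℂ) :
    complexVariance (fun ω => c * X ω) P = ‖c‖ ^ 2 * complexVariance X P := by
  simp only [complexVariance, integral_const_mul, ← mul_sub, norm_mul, mul_pow]

theorem complexVariance_nonneg (X : Ω → ℂ) : 0 ≤ complexVariance X P :=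
  integral_nonneg fun _ => sq_nonneg _

theorem complexVariance_comp {E : Type*} [MeasurableSpace E] {ξ : Ω → E} (hξ : Measurable ξ)
    {g : E → ℂ} (hg : Measurable g) :
    complexVariance (fun ω => g (ξ ω)) P = complexVariance g (P.map ξ) := by
  rw [complexVariance, complexVariance, integral_map hξ.aemeasurable hg.aestronglyMeasurable,
    integral_map hξ.aemeasurable
      (((hg.sub_const _).norm.pow_const 2).aestronglyMeasurable)]

/-- Mean and variance of a sum over finitely many strata of averages of `N` independent samples. -/
theorem stratified_estimator {E σ : Type*} [MeasurableSpace E] [Fintype σ] {μ : Measure E}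
    [IsProbabilityMeasure P] {N : ℕ} (hN : 0 < N) {ξ : σ × Fin N → Ω → E}
    (hξ : ∀ s, Measurable (ξ s)) (hlaw : ∀ s, P.map (ξ s) = μ) (hind : iIndepFun ξ P)
    (c : σ → ℝ) {f : σ → E → ℂ} (hf : ∀ s, Measurable (f s)) {K : ℝ}
    (hK : ∀ s, ∀ᵐ e ∂μ, ‖f s e‖ ≤ K) :
    MemLp (fun ω => ∑ s, (1 / (N : ℂ)) * (c s : ℂ) * ∑ l, f s (ξ (s, l) ω)) 2 P ∧
      ∫ ω, ∑ s, (1 / (N : ℂ)) * (c s : ℂ) * ∑ l, f s (ξ (s, l) ω) ∂P =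
        ∑ s, (c s : ℂ) * ∫ e, f s e ∂μ ∧
      complexVariance (fun ω => ∑ s, (1 / (N : ℂ)) * (c s : ℂ) * ∑ l, f s (ξ (s, l) ω)) P =
        (∑ s, c s ^ 2 * complexVariance (f s) μ) / N := by
  have hN0 : (N : ℝ) ≠ 0 := by exact_mod_cast hN.ne'
  have hNC : (N : ℂ) ≠ 0 := by exact_mod_cast hN.ne'
  let X : σ × Fin N → Ω → ℂ := fun s ω => 1 / (N : ℂ) * (c s.1 : ℂ) * f s.1 (ξ s ω)
  have hsum : (fun ω => ∑ s, (1 / (N : ℂ)) * (c s : ℂ) * ∑ l, f s (ξ (s, l) ω)) =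
      fun ω => ∑ s, X s ω := by
    ext ω
    rw [Fintype.sum_prod_type]
    exact Finset.sum_congr rfl fun s _ => Finset.mul_sum _ _ _
  have hfX : ∀ s, MemLp (fun ω => f s.1 (ξ s ω)) 2 P := fun s =>
    MemLp.of_bound ((hf s.1).comp (hξ s)).aestronglyMeasurable K
      (ae_of_ae_map (hξ s).aemeasurable (by rw [hlaw s]; exact hK s.1))
  have hX : ∀ s, MemLp (X s) 2 P := fun s => (hfX s).const_mul _
  have hXind : iIndepFun X P :=
    hind.comp (fun s e => 1 / (N : ℂ) * (c s.1 : ℂ) * f s.1 e) fun s => (hf s.1).const_mul _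
  simp only [hsum]
  refine ⟨memLp_finsetSum _ fun s _ => hX s, ?_, ?_⟩
  · rw [integral_finsetSum _ fun s _ => (hX s).integrable (by norm_num), Fintype.sum_prod_type]
    refine Finset.sum_congr rfl fun s _ => ?_
    have : ∀ l, ∫ ω, X (s, l) ω ∂P = 1 / (N : ℂ) * ((c s : ℂ) * ∫ e, f s e ∂μ) := fun l => by
      rw [integral_const_mul, ← hlaw (s, l),
        integral_map (hξ _).aemeasurable (hf s).aestronglyMeasurable, mul_assoc]
    simp only [this, Finset.sum_const, Finset.card_univ, Fintype.card_fin, nsmul_eq_mul]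
    field_simp
  -- Each stratum contributes `N` equal terms with factor `(c s / N)²`, hence `c s ² / N` in total.
  · rw [complexVariance_sum hX hXind, Fintype.sum_prod_type, Finset.sum_div]
    refine Finset.sum_congr rfl fun s _ => ?_
    have : ∀ l, complexVariance (X (s, l)) P =
        (1 / (N : ℝ) * c s) ^ 2 * complexVariance (f s) μ := fun l => by
      rw [complexVariance_const_mul, complexVariance_comp (hξ _) (hf s), hlaw (s, l)]
      congr 1
      rw [show (1 / (N : ℂ) * (c s : ℂ)) = ((1 / (N : ℝ) * c s : ℝ) : ℂ) by push_cast; rfl,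
        Complex.norm_real, Real.norm_eq_abs, sq_abs]
    simp only [this, Finset.sum_const, Finset.card_univ, Fintype.card_fin, nsmul_eq_mul]
    field_simp

end Variance

/-! ### The sector decomposition of the integral -/

theorem sectorPoint_eq_exp {d : ℕ} (u : Fin d → Fin (d + 1) → ℝ) (w : Fin (d + 1) → ℝ)
    {ξ : Fin d → ℝ} (hξ : ξ ∈ unitCube d) :
    sectorPoint u w ξ = fun k =>
      Real.exp ((∑ i, (-Real.log (ξ i) / (u i ⬝ᵥ w)) • u i) k) := by
  ext k
  rw [sectorPoint, Finset.sum_apply, Real.exp_sum]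
  refine Finset.prod_congr rfl fun i _ => ?_
  rw [Real.rpow_def_of_pos (mem_unitCube.1 hξ i).1, Pi.smul_apply, smul_eq_mul]
  congr 1
  ring

theorem measurable_sectorPoint {d : ℕ} (u : Fin d → Fin (d + 1) → ℝ) (w : Fin (d + 1) → ℝ) :
    Measurable (sectorPoint u w) :=
  measurable_pi_lambda _ fun _ => Finset.measurable_fun_prod _ fun i _ =>
    (measurable_pi_apply i).pow_const _

theorem chart_exp {d : ℕ} (y : Fin d → ℝ) :
    chart (fun k => Real.exp (y k)) = fun k => Real.exp (Fin.snoc (α := fun _ => ℝ) y 0 k) := by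
  ext k
  refine Fin.lastCases ?_ (fun _ => ?_) k <;> simp [chart]

/-- A sector point is not normalised to have last coordinate `1`; it differs from the chart point by
a positive scalar, which `integrand_smul` removes. -/
theorem exp_eq_smul_chart {d : ℕ} (y : Fin (d + 1) → ℝ) :
    (fun k => Real.exp (y k)) =
      Real.exp (y (Fin.last d)) • chart (fun k => Real.exp (dehomogenize y k)) := by
  rw [chart_exp]
  ext k
  conv_lhs => rw [snoc_dehomogenize y]
  rw [Pi.smul_apply, smul_eq_mul, ← Real.exp_add, Pi.add_apply, Pi.smul_apply, Pi.one_apply,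
    smul_eq_mul, mul_one, add_comm]

theorem measurable_chart (d : ℕ) : Measurable (chart : (Fin d → ℝ) → Fin (d + 1) → ℝ) := by
  refine measurable_pi_lambda _ fun k => ?_
  refine Fin.lastCases ?_ (fun k => ?_) k
  · simp [chart]
  · simpa [chart] using measurable_pi_apply k

/-- The integral over projective space in logarithmic coordinates. -/
theorem integral_canonicalMeasure {d : ℕ} {f : (Fin (d + 1) → ℝ) → ℂ} (hf : Measurable f) :
    (Integrable (fun x => f (chart x)) (canonicalMeasure d) ↔
      Integrable fun y : Fin d → ℝ => f (chart fun k => Real.exp (y k))) ∧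
    ∫ x, f (chart x) ∂(canonicalMeasure d) =
      ∫ y : Fin d → ℝ, f (chart fun k => Real.exp (y k)) := by
  have hg : Measurable fun y : Fin d → ℝ => f (chart fun k => Real.exp (y k)) :=
    hf.comp ((measurable_chart d).comp (by fun_prop))
  have hae : (fun x => f (chart x)) =ᵐ[canonicalMeasure d]
      fun x => f (chart fun k => Real.exp (Real.log (x k))) := by
    filter_upwards [ae_canonicalMeasure_mem d] with x hx
    congr 2
    ext k
    rw [Real.exp_log (hx k)]
  have hm := (measurable_log_pi d).aemeasurable (μ := canonicalMeasure d)
  constructor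
  · rw [integrable_congr hae, ← map_log_canonicalMeasure d,
      integrable_map_measure hg.aestronglyMeasurable hm]
    rfl
  · rw [integral_congr_ae hae, ← map_log_canonicalMeasure d,
      integral_map hm hg.aestronglyMeasurable]

theorem measurableSet_coneSpan {d : ℕ} {v : Fin d → Fin d → ℝ} (hv : LinearIndependent ℝ v) :
    MeasurableSet (coneSpan v) := by
  rw [← image_cubeToCone v (c := fun _ => 1) fun _ => one_pos]
  exact measurable_image_of_fderivWithin (measurableSet_unitCube d)
    (fun ξ hξ => (hasFDerivAt_cubeToCone v _ hξ).hasFDerivWithinAt)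
    (injOn_cubeToCone hv fun _ => one_pos)

end EulerMellin

open EulerMellin
theorem proposition4p5 {d : ℕ} {ι κ : Type*} [Fintype ι] [Fintype κ]
    (a : ι → MvPolynomial (Fin (d + 1)) ℂ) (b : κ → MvPolynomial (Fin (d + 1)) ℂ)
    (ν : ι → ℂ) (ρ : κ → ℂ)
    (α : ι → (Fin (d + 1) → ℝ) → ℂ) (β : κ → (Fin (d + 1) → ℝ) → ℂ)
    (ha0 : ∀ i, a i ≠ 0) (hb0 : ∀ j, b j ≠ 0)
    (ha : ∀ i, (a i).IsHomogeneous (a i).totalDegree)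
    (hb : ∀ j, (b j).IsHomogeneous (b j).totalDegree)
    (hdeg : ∑ i, ν i * ((a i).totalDegree : ℂ) = ∑ j, ρ j * ((b j).totalDegree : ℂ))
    (hν : ∀ i, 0 ≤ (ν i).re) (hρ : ∀ j, 0 ≤ (ρ j).re)
    (hα : ∀ i, IsLogBranch (a i) (α i)) (hβ : ∀ j, IsLogBranch (b j) (β j))
    (R1 : Module.finrank ℝ (vectorSpan ℝ (weightedNewtonPolytope b ρ)) = d)
    (R2 : weightedNewtonPolytope a ν ⊆ intrinsicInterior ℝ (weightedNewtonPolytope b ρ))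
    (R3 : ∀ j, CompletelyNonvanishing (b j))
    (𝓕 : Finset (Set (TropSpace (d + 1))))
    (h𝓕 : IsSimplicialRefinement (weightedNewtonPolytope a ν) (weightedNewtonPolytope b ρ) 𝓕)
    (u : maximalCones 𝓕 → Fin d → Fin (d + 1) → ℝ)
    (w : maximalCones 𝓕 → Fin (d + 1) → ℝ)
    (hT : IsSectorTable (weightedNewtonPolytope a ν) (weightedNewtonPolytope b ρ) 𝓕 u w) :
    Integrable (fun x => integrand a b ν ρ α β (chart x)) (canonicalMeasure d) ∧
    (∃ K : ℝ, ∀ x ∈ posOrthant (d + 1), ‖residual a b ν ρ α β x‖ ≤ K) ∧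
    ∃ C : ℝ, 0 ≤ C ∧
      ∀ (N : ℕ), 0 < N →
      ∀ (Ω : Type*) [MeasurableSpace Ω] (P : Measure Ω) [IsProbabilityMeasure P]
        (ξ : maximalCones 𝓕 × Fin N → Ω → Fin d → ℝ),
        (∀ s, Measurable (ξ s)) →
        (∀ s, P.map (ξ s) = volume.restrict (Set.Icc (0 : Fin d → ℝ) 1)) →
        iIndepFun ξ P →
        let I_N : Ω → ℂ := fun ω =>
          basicEstimator u w (residual a b ν ρ α β) fun C l => ξ (C, l) ω
        MemLp I_N 2 P ∧
        ∫ ω, I_N ω ∂P = ∫ x, integrand a b ν ρ α β (chart x) ∂(canonicalMeasure d) ∧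
        complexVariance I_N P = C / N := by
  set A := weightedNewtonPolytope a ν with hA
  set B := weightedNewtonPolytope b ρ with hB
  have hcov : ∀ q, ∃ C ∈ 𝓕, q ∈ C := h𝓕.exists_mem
    (fun y => exists_forall_dotProduct_le ha0 hν y) fun y => exists_forall_dotProduct_le hb0 hρ y
  have hAdeg := fun v (hv : v ∈ A) => one_dotProduct_of_mem_weightedNewtonPolytope ha hv
  have hBdeg := fun v (hv : v ∈ B) => one_dotProduct_of_mem_weightedNewtonPolytope hb hv
  have hLI : ∀ C, LinearIndependent ℝ fun k => toTrop (u C k) := fun C => by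
    refine linearIndependent_of_coneDim_eq ?_
    rw [← hT.generators C]
    exact coneDim_of_mem_maximalCones hcov C.2
  -- Each generator lies in its own cone, so `wB` maximises it over `B`; `wA` is a relative interior
  -- point of `B` by (R2).
  have hpos : ∀ C i, 0 < u C i ⬝ᵥ w C := fun C i => by
    obtain ⟨wA, hwA, wB, hwB, hw, hmax⟩ := hT.weights C
    rw [hw]
    refine dotProduct_sub_pos hBdeg R1 ((hLI C).ne_zero i) (R2 hwA) (hmax _ ?_).2
    rw [hT.generators C]
    exact ⟨Pi.single i 1, fun k => by by_cases h : k = i <;> simp [h],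
      by simp [Pi.single_apply]⟩
  obtain ⟨K, hK⟩ := exists_norm_residual_le ha0 hb0 hν hρ hα hβ R3
  set R := residual a b ν ρ α β with hR
  have hRm : Measurable R := measurable_residual ν ρ hα hβ
  have hfm : ∀ C, Measurable fun ξ => R (sectorPoint (u C) (w C) ξ) := fun C =>
    hRm.comp (measurable_sectorPoint _ _)
  have hmem : ∀ C, ∀ ξ ∈ unitCube d, sectorPoint (u C) (w C) ξ ∈ posOrthant (d + 1) :=
    fun C ξ hξ k => by
      rw [sectorPoint_eq_exp _ _ hξ]
      exact Real.exp_pos _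
  have hfb : ∀ C, ∀ᵐ ξ ∂(volume.restrict (unitCube d)), ‖R (sectorPoint (u C) (w C) ξ)‖ ≤ K :=
    fun C => by
      filter_upwards [ae_restrict_mem (measurableSet_unitCube d)] with ξ hξ
      exact hK _ (hmem C ξ hξ)
  have hcube : volume.restrict (unitCube d) = volume.restrict (Set.Icc (0 : Fin d → ℝ) 1) :=
    Measure.restrict_congr_set (unitCube_ae_eq d)
  have hfin : IsFiniteMeasure (volume.restrict (unitCube d)) := by
    rw [hcube]
    exact ⟨by rw [Measure.restrict_apply_univ]; exact isCompact_Icc.measure_lt_top⟩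
  have hfi : ∀ C, IntegrableOn (fun ξ => R (sectorPoint (u C) (w C) ξ)) (unitCube d) := fun C =>
    Integrable.of_bound (hfm C).aestronglyMeasurable K (hfb C)
  let g : (Fin d → ℝ) → ℂ := fun y => integrand a b ν ρ α β (chart fun k => Real.exp (y k))
  -- `Y` is the logarithm of the sector point and lies in the cone. The tropical factor there is
  -- `exp(-⟨Y, w⟩)`, and the weights in `Y` are chosen so that this equals `∏ ξᵢ`.
  have hg : ∀ C, ∀ ξ ∈ unitCube d,
      g (cubeToCone (fun k => dehomogenize (u C k)) (fun i => u C i ⬝ᵥ w C) ξ) =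
        R (sectorPoint (u C) (w C) ξ) * ((∏ i, ξ i : ℝ) : ℂ) := fun C ξ hξ => by
    obtain ⟨wA, hwA, wB, hwB, hw, hmax⟩ := hT.weights C
    set Y := ∑ i, (-Real.log (ξ i) / (u C i ⬝ᵥ w C)) • u C i with hY
    have hYd : cubeToCone (fun k => dehomogenize (u C k)) (fun i => u C i ⬝ᵥ w C) ξ =
        dehomogenize Y := by
      ext k
      simp only [cubeToCone, dehomogenize, hY, Finset.sum_apply, Pi.smul_apply, smul_eq_mul,
        ← Finset.sum_sub_distrib, mul_sub]
    have hYC : toTrop Y ∈ (C : Set (TropSpace (d + 1))) := by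
      rw [hT.generators C]
      refine ⟨fun i => -Real.log (ξ i) / (u C i ⬝ᵥ w C), fun i => ?_, ?_⟩
      · have := mem_unitCube.1 hξ i
        exact div_nonneg (neg_nonneg.2 (Real.log_nonpos this.1.le this.2)) (hpos C i).le
      · simp [hY, toTrop, map_sum]
    have hYw : Y ⬝ᵥ w C = -∑ i, Real.log (ξ i) := by
      rw [hY, sum_dotProduct, ← Finset.sum_neg_distrib]
      refine Finset.sum_congr rfl fun i _ => ?_
      rw [smul_dotProduct, smul_eq_mul, div_mul_cancel₀ _ (hpos C i).ne']
    have hchart : chart (fun k => Real.exp (dehomogenize Y k)) ∈ posOrthant (d + 1) := fun k => by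
      rw [chart_exp]
      exact Real.exp_pos _
    have h1 : g (dehomogenize Y) = integrand a b ν ρ α β (sectorPoint (u C) (w C) ξ) := by
      rw [sectorPoint_eq_exp _ _ hξ, exp_eq_smul_chart Y,
        integrand_smul ha hb hdeg hα hβ hchart (Real.exp_pos _)]
    rw [hYd, h1, integrand_eq_residual_mul ν ρ α β ha0 hb0 (hmem C ξ hξ),
      sectorPoint_eq_exp _ _ hξ, prod_trop_rpow_eq ha0 hν hwA (hmax Y hYC).1,
      prod_trop_rpow_eq hb0 hρ hwB (hmax Y hYC).2, ← Real.exp_sub, ← dotProduct_sub,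
      ← neg_sub wB wA, ← hw, dotProduct_neg, hYw, neg_neg, Real.exp_sum]
    congr 3
    exact funext fun i => Real.exp_log (mem_unitCube.1 hξ i).1
  have hcone : ∀ C : maximalCones 𝓕, tropChart d ⁻¹' (C : Set (TropSpace (d + 1))) =
      coneSpan fun k => dehomogenize (u C k) := fun C => by
    rw [hT.generators C, preimage_tropChart_coneSpan]
  have hsec := fun C => integrableOn_and_integral_coneSpan
    (linearIndependent_dehomogenize (hLI C)) (hpos C) (hg C) (hfi C)
  have hUnion : IntegrableOn g
      (⋃ C : maximalCones 𝓕, tropChart d ⁻¹' (C : Set (TropSpace (d + 1)))) :=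
    integrableOn_finite_iUnion.2 fun C => by rw [hcone C]; exact (hsec C).1
  have hae := iUnion_maximalCones_ae_eq_univ hcov
  have hgint : Integrable g := by
    rw [← integrableOn_univ]
    exact hUnion.congr_set_ae hae.symm
  have hgI : ∫ y, g y = ∑ C, (sectorPrefactor (u C) (w C) : ℂ) *
      ∫ ξ in Set.Icc (0 : Fin d → ℝ) 1, R (sectorPoint (u C) (w C) ξ) := by
    rw [← setIntegral_univ, ← setIntegral_congr_set hae, integral_iUnion_ae _ _ hUnion,
      tsum_fintype]
    · refine Finset.sum_congr rfl fun C _ => ?_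
      rw [hcone C, (hsec C).2, hcube, sectorPrefactor, det_snoc_one]
    · intro C
      rw [hcone C]
      exact (measurableSet_coneSpan (linearIndependent_dehomogenize (hLI C))).nullMeasurableSet
    · intro C C' hne
      exact h𝓕.isFan.aedisjoint (mem_of_mem_maximalCones C.2) (mem_of_mem_maximalCones C'.2)
        fun h => hne (Subtype.ext h)
  have hcan := integral_canonicalMeasure (d := d) (measurable_integrand ν ρ hα hβ)
  -- `C` is the sum over sectors of the squared prefactor times the variance of a single sample, so
  -- it involves neither `N` nor the probability space.
  refine ⟨hcan.1.2 hgint, ⟨K, hK⟩, ∑ C, sectorPrefactor (u C) (w C) ^ 2 *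
    complexVariance (fun ξ => R (sectorPoint (u C) (w C) ξ))
      (volume.restrict (Set.Icc (0 : Fin d → ℝ) 1)),
    Finset.sum_nonneg fun C _ => mul_nonneg (sq_nonneg _) (complexVariance_nonneg _), ?_⟩
  intro N hN Ω _ P _ ξ hξ hlaw hind
  obtain ⟨h1, h2, h3⟩ := stratified_estimator hN hξ hlaw hind
    (fun C => sectorPrefactor (u C) (w C)) hfm (fun C => hcube ▸ hfb C)
  exact ⟨h1, h2.trans (hgI.symm.trans hcan.2.symm), h3⟩
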